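/- **Setting.** Let $n$ be the number of vehicles, and let $0<R_{in}<R_{out}$, $v_{\max}>0$, $\omega^*\in(0,v_{\max}/R_{out})$ and $\Theta\in(0,\pi/2)$ with $\cos\Theta>R_{out}\omega^*/v_{\max}$. Let $\sigma_i>0$, $p_{i,j}=p_{j,i}>0$ for $i,j=1,\dots,n$, $L_{i,j}=L_{j,i}>0$ for $i\ne j$, and let $\lambda>0$ satisfy $\lambda>L_{i,j}$ for all $i\neq j$. Let $A>0$ and $b>1/R_{in}^2$. For $w=(r,\varphi,s,v)\in\mathbb R^{4n}$ put $$d_{i,j}=\sqrt{p_{i,j}(r_i-r_j)^2+2r_ir_j(1-\cos(\varphi_i-\varphi_j))},$$ $$\Omega=\{w:\ r_i\in(R_{in},R_{out}),\ s_i\in(-\Theta,\Theta),\ v_i\in(0,v_{\max})\ \text{for all } i,\ \ d_{i,j}>L_{i,j}\ \text{for all } j\ne i\}.$$ For $i\ne j$ let $V_{i,j}=V_{j,i}:(L_{i,j},\infty)\to[0,\infty)$ be $C^2$ with $V_{i,j}(d)\to+\infty$ as $d\to L_{i,j}^+$ and $V_{i,j}(d)=0$ for $d\ge\lambda$; let $\kappa_{i,j}=\kappa_{j,i}:(L_{i,j},\infty)\to[0,\infty)$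 be $C^1$ with $\kappa_{i,j}(d)=0$ for $d\ge\lambda$; let $U_i:(R_{in},R_{out})\to[0,\infty)$ be $C^2$ with $U_i(r)\to+\infty$ as $r\to R_{in}^+$ and as $r\to R_{out}^-$. Let $g_1,g_2:\mathbb R\to\mathbb R$ be $C^1$ and non-decreasing, and let $f_1,f_2:\mathbb R\to\mathbb R$ be $C^1$ with $f_k(0)=0$ and $xf_k(x)>0$ for $x\neq0$. For $w\in\Omega$ define $$\begin{aligned}H_R(w)={}&\frac12\sum_i\frac{\left(\frac{v_i}{r_i}\cos s_i-\omega^*\right)^2+bv_i^2\sin^2 s_i}{(v_{\max}-v_i)v_i}+\sum_iU_i(r_i)+\frac12\sum_i\sum_{j\ne i}V_{i,j}(d_{i,j})\\&+A\sum_i\left(\frac1{\cos s_i-\cos\Theta}-\frac1{1-\cos\Theta}\right),\end{aligned}$$ $$\Phi_i(w)=\frac{r_i}{\omega^*}\sum_{j\ne i}V_{i,j}'(d_{i,j})\frac{r_j\sin(\varphi_i-\varphi_j)}{d_{i,j}},\qquad G_i(w)=\frac1{\omega^*}\sum_{j\ne i}\kappa_{i,j}(d_{i,j})\left(g_1\!\left(\tfrac{v_j}{r_j}\cos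 s_j\right)-g_1\!\left(\tfrac{v_i}{r_i}\cos s_i\right)\right),$$ $$M_i(w)=\sum_{j\ne i}\kappa_{i,j}(d_{i,j})\left(g_2(\sin s_j)-g_2(\sin s_i)\right),\qquad q(r,s,v)=\frac{v_{\max}v\cos s-2rv\omega^*+r\omega^*v_{\max}}{2r(v_{\max}-v)^2v^2},$$ $$\gamma(r,s,v)=\frac{A}{(\cos s-\cos\Theta)^2}+\frac{v\cos s}{v_{\max}-v}\left(b-\frac1{r^2}\right)+\frac{\omega^*}{r(v_{\max}-v)},\qquad \zeta(s,v)=\frac{bv_{\max}\sin s}{2(v_{\max}-v)^2v},$$ $$Z_i(w)=\left(\frac{v_i}{r_i}\cos s_i-\omega^*\right)\frac{\cos s_i}{(v_{\max}-v_i)r_i^2}-U_i'(r_i)-\sum_{j\ne i}\left(p_{i,j}(r_i-r_j)+r_j(1-\cos(\varphi_i-\varphi_j))\right)\frac{V_{i,j}'(d_{i,j})}{d_{i,j}}.$$ The Pseudo-Relativistic Cruise Controller is the feedback $$F_i=-\frac1{q(r_i,s_i,v_i)}\left(f_1\!\left(\tfrac{v_i}{r_i}\cos s_i-\omega^*\right)+\omega^*(\Phi_i(w)-G_i(w))\right),$$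 $$\delta_i=\arctan\!\left(\frac{\sigma_i}{r_i}\cos s_i-\frac{\sigma_i}{\gamma(r_i,s_i,v_i)v_i}\Big(f_2(\sin s_i)+\big(\zeta(s_i,v_i)F_i+Z_i(w)\big)v_i-M_i(w)\Big)\right),$$ and the closed-loop system is, for $i=1,\dots,n$, $$\dot r_i=-v_i\sin s_i,\quad \dot\varphi_i=\frac{v_i}{r_i}\cos s_i,\quad \dot s_i=\frac{v_i}{\sigma_i}\tan\delta_i-\frac{v_i}{r_i}\cos s_i,\quad \dot v_i=F_i.$$ **Theorem.** For every $w_0\in\Omega$ the closed-loop system with $w(0)=w_0$ has a unique solution $w(t)$; it is defined for all $t\ge0$, satisfies $w(t)\in\Omega$ for all $t\ge0$, and for every $i=1,\dots,n$, as $t\to+\infty$, $$s_i(t)\to0,\qquad \frac{v_i(t)}{r_i(t)}\to\omega^*,\qquad \dot s_i(t)\to0,\qquad F_i(t)\to0.$$ Furthermore $H_R\ge 0$ on $\Omega$, and there is a non-decreasing function $P_2:[0,\infty)\to[0,\infty)$, independent of $w_0$, such that for every $w_0\in\Omega$ the corresponding solution satisfies $$|F_i(t)|+|\delta_i(t)|\le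 P_2(H_R(w_0))\qquad\text{for all }t\ge0,\ i=1,\dots,n.$$ -/

import Mathlib

open Set Filter Topology

noncomputable section

/-- The data of a ring-road with `n` vehicles together with the design parameters of the
pseudo-relativistic cruise controller. Functions that are only meaningful on an interval
(`V i j` and `κ i j` on `(L i j, ∞)`, `U i` on `(Rin, Rout)`) are total functions whose values
outside that interval are irrelevant, as are the entries `V i i`, `κ i i`, `L i i`. -/
structure RingRoad (n : ℕ) where
  /-- inner radius -/
  Rin : ℝ
  /-- outer radius -/
  Rout : ℝ
  /-- speed limit -/
  vmax : ℝ
  /-- angular speed set-point -/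
  ω : ℝ
  /-- maximal relative orientation -/
  Θ : ℝ
  /-- lengths of the vehicles -/
  σ : Fin n → ℝ
  /-- weights in the inter-vehicle distance -/
  p : Fin n → Fin n → ℝ
  /-- minimal inter-vehicle distances -/
  L : Fin n → Fin n → ℝ
  /-- interaction range -/
  lam : ℝ
  /-- vehicle-repulsive potentials -/
  V : Fin n → Fin n → ℝ → ℝ
  /-- boundary-repulsive potentials -/
  U : Fin n → ℝ → ℝ
  /-- viscosity coefficients -/
  κ : Fin n → Fin n → ℝ → ℝ
  /-- weight of the orientation penalty in the Lyapunov function -/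
  A : ℝ
  /-- weight of the radial kinetic energy in the Lyapunov function -/
  b : ℝ
  g₁ : ℝ → ℝ
  g₂ : ℝ → ℝ
  f₁ : ℝ → ℝ
  f₂ : ℝ → ℝ

/-- The states `w = (r, φ, s, v) ∈ ℝ⁴ⁿ`. -/
abbrev State (n : ℕ) : Type := (Fin n → ℝ) × (Fin n → ℝ) × (Fin n → ℝ) × (Fin n → ℝ)

namespace State

variable {n : ℕ}

/-- radial coordinates -/
def r (w : State n) : Fin n → ℝ := w.1
/-- angular coordinates -/
def φ (w : State n) : Fin n → ℝ := w.2.1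
/-- relative orientations -/
def s (w : State n) : Fin n → ℝ := w.2.2.1
/-- speeds -/
def v (w : State n) : Fin n → ℝ := w.2.2.2

end State

namespace RingRoad

variable {n : ℕ}

/-- The standing assumptions on the road, the vehicles and the design parameters. -/
structure IsAdmissible (P : RingRoad n) : Prop where
  Rin_pos : 0 < P.Rin
  Rin_lt_Rout : P.Rin < P.Rout
  vmax_pos : 0 < P.vmax
  ω_pos : 0 < P.ω
  ω_lt : P.ω < P.vmax / P.Rout
  Θ_pos : 0 < P.Θ
  Θ_lt : P.Θ < Real.pi / 2
  cos_Θ : P.Rout * P.ω / P.vmax < Real.cos P.Θ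
  σ_pos : ∀ i, 0 < P.σ i
  p_pos : ∀ i j, 0 < P.p i j
  p_symm : ∀ i j, P.p i j = P.p j i
  L_pos : ∀ i j, i ≠ j → 0 < P.L i j
  L_symm : ∀ i j, i ≠ j → P.L i j = P.L j i
  lam_pos : 0 < P.lam
  L_lt_lam : ∀ i j, i ≠ j → P.L i j < P.lam
  V_contDiffOn : ∀ i j, i ≠ j → ContDiffOn ℝ 2 (P.V i j) (Ioi (P.L i j))
  V_nonneg : ∀ i j, i ≠ j → ∀ d, P.L i j < d → 0 ≤ P.V i j d
  V_tendsto : ∀ i j, i ≠ j → Tendsto (P.V i j) (𝓝[>] (P.L i j)) atTop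
  V_eq_zero : ∀ i j, i ≠ j → ∀ d, P.lam ≤ d → P.V i j d = 0
  V_symm : ∀ i j, i ≠ j → ∀ d, P.L i j < d → P.V i j d = P.V j i d
  U_contDiffOn : ∀ i, ContDiffOn ℝ 2 (P.U i) (Ioo P.Rin P.Rout)
  U_nonneg : ∀ i, ∀ x ∈ Ioo P.Rin P.Rout, 0 ≤ P.U i x
  U_tendsto_Rin : ∀ i, Tendsto (P.U i) (𝓝[>] P.Rin) atTop
  U_tendsto_Rout : ∀ i, Tendsto (P.U i) (𝓝[<] P.Rout) atTop
  κ_contDiffOn : ∀ i j, i ≠ j → ContDiffOn ℝ 1 (P.κ i j) (Ioi (P.L i j))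
  κ_nonneg : ∀ i j, i ≠ j → ∀ d, P.L i j < d → 0 ≤ P.κ i j d
  κ_symm : ∀ i j, i ≠ j → ∀ d, P.L i j < d → P.κ i j d = P.κ j i d
  κ_eq_zero : ∀ i j, i ≠ j → ∀ d, P.lam ≤ d → P.κ i j d = 0
  A_pos : 0 < P.A
  b_gt : 1 / P.Rin ^ 2 < P.b
  g₁_contDiff : ContDiff ℝ 1 P.g₁
  g₁_mono : Monotone P.g₁
  g₂_contDiff : ContDiff ℝ 1 P.g₂
  g₂_mono : Monotone P.g₂
  f₁_contDiff : ContDiff ℝ 1 P.f₁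
  f₁_zero : P.f₁ 0 = 0
  f₁_sign : ∀ x, x ≠ 0 → 0 < x * P.f₁ x
  f₂_contDiff : ContDiff ℝ 1 P.f₂
  f₂_zero : P.f₂ 0 = 0
  f₂_sign : ∀ x, x ≠ 0 → 0 < x * P.f₂ x

/-- The weighted distance `d_{i,j}` between vehicles `i` and `j`. -/
def dist (P : RingRoad n) (w : State n) (i j : Fin n) : ℝ :=
  Real.sqrt (P.p i j * (w.r i - w.r j) ^ 2
    + 2 * w.r i * w.r j * (1 - Real.cos (w.φ i - w.φ j)))

/-- The state space `Ω`. -/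
def Ω (P : RingRoad n) : Set (State n) :=
  {w | (∀ i, w.r i ∈ Ioo P.Rin P.Rout) ∧ (∀ i, w.s i ∈ Ioo (-P.Θ) P.Θ) ∧
    (∀ i, w.v i ∈ Ioo 0 P.vmax) ∧ ∀ i j, j ≠ i → P.L i j < P.dist w i j}

/-- The Lyapunov function `H_R`. -/
def HR (P : RingRoad n) (w : State n) : ℝ :=
  (1 / 2) * ∑ i, ((w.v i / w.r i * Real.cos (w.s i) - P.ω) ^ 2
        + P.b * w.v i ^ 2 * Real.sin (w.s i) ^ 2) / ((P.vmax - w.v i) * w.v i)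
    + ∑ i, P.U i (w.r i)
    + (1 / 2) * ∑ i, ∑ j ∈ Finset.univ.erase i, P.V i j (P.dist w i j)
    + P.A * ∑ i, (1 / (Real.cos (w.s i) - Real.cos P.Θ) - 1 / (1 - Real.cos P.Θ))

/-- `Φ_i`; the derivative of `V i j` is taken at a point of its open domain when `w ∈ Ω`. -/
def Φ (P : RingRoad n) (w : State n) (i : Fin n) : ℝ :=
  w.r i / P.ω * ∑ j ∈ Finset.univ.erase i,
    deriv (P.V i j) (P.dist w i j) * (w.r j * Real.sin (w.φ i - w.φ j) / P.dist w i j)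

/-- `G_i` -/
def G (P : RingRoad n) (w : State n) (i : Fin n) : ℝ :=
  1 / P.ω * ∑ j ∈ Finset.univ.erase i, P.κ i j (P.dist w i j) *
    (P.g₁ (w.v j / w.r j * Real.cos (w.s j)) - P.g₁ (w.v i / w.r i * Real.cos (w.s i)))

/-- `M_i` -/
def M (P : RingRoad n) (w : State n) (i : Fin n) : ℝ :=
  ∑ j ∈ Finset.univ.erase i, P.κ i j (P.dist w i j) *
    (P.g₂ (Real.sin (w.s j)) - P.g₂ (Real.sin (w.s i)))

/-- `q(r, s, v)` -/
def q (P : RingRoad n) (r s v : ℝ) : ℝ :=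
  (P.vmax * v * Real.cos s - 2 * r * v * P.ω + r * P.ω * P.vmax)
    / (2 * r * (P.vmax - v) ^ 2 * v ^ 2)

/-- `γ(r, s, v)` -/
def γ (P : RingRoad n) (r s v : ℝ) : ℝ :=
  P.A / (Real.cos s - Real.cos P.Θ) ^ 2
    + v * Real.cos s / (P.vmax - v) * (P.b - 1 / r ^ 2)
    + P.ω / (r * (P.vmax - v))

/-- `ζ(s, v)` -/
def ζ (P : RingRoad n) (s v : ℝ) : ℝ :=
  P.b * P.vmax * Real.sin s / (2 * (P.vmax - v) ^ 2 * v)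

/-- `Z_i` -/
def Z (P : RingRoad n) (w : State n) (i : Fin n) : ℝ :=
  (w.v i / w.r i * Real.cos (w.s i) - P.ω) * (Real.cos (w.s i) / ((P.vmax - w.v i) * w.r i ^ 2))
    - deriv (P.U i) (w.r i)
    - ∑ j ∈ Finset.univ.erase i,
        (P.p i j * (w.r i - w.r j) + w.r j * (1 - Real.cos (w.φ i - w.φ j)))
          * (deriv (P.V i j) (P.dist w i j) / P.dist w i j)

/-- The acceleration `F_i` commanded by the pseudo-relativistic cruise controller. -/
def F (P : RingRoad n) (w : State n) (i : Fin n) : ℝ :=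
  -(1 / P.q (w.r i) (w.s i) (w.v i)) *
    (P.f₁ (w.v i / w.r i * Real.cos (w.s i) - P.ω) + P.ω * (P.Φ w i - P.G w i))

/-- The steering angle `δ_i` commanded by the pseudo-relativistic cruise controller. -/
def δ (P : RingRoad n) (w : State n) (i : Fin n) : ℝ :=
  Real.arctan (P.σ i / w.r i * Real.cos (w.s i)
    - P.σ i / (P.γ (w.r i) (w.s i) (w.v i) * w.v i) *
      (P.f₂ (Real.sin (w.s i))
        + (P.ζ (w.s i) (w.v i) * P.F w i + P.Z w i) * w.v i - P.M w i))

/-- The right-hand side of the bicycle model in polar coordinates, for inputs `F` and `δ`. -/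
def bicycle (P : RingRoad n) (w : State n) (F δ : Fin n → ℝ) : State n :=
  (fun i => -(w.v i) * Real.sin (w.s i),
   fun i => w.v i / w.r i * Real.cos (w.s i),
   fun i => w.v i / P.σ i * Real.tan (δ i) - w.v i / w.r i * Real.cos (w.s i),
   fun i => F i)

/-- `w` is a solution, on the time interval `J` containing `0`, of the closed-loop initial-value
problem with initial state `w₀`. The feedback is defined on `Ω` only, so a solution takes values
in `Ω`; derivatives at end points of `J` are one-sided. -/
structure IsSolutionOn (P : RingRoad n) (w₀ : State n) (J : Set ℝ) (w : ℝ → State n) : Prop where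
  init : w 0 = w₀
  mem : ∀ t ∈ J, w t ∈ P.Ω
  deriv : ∀ t ∈ J, HasDerivWithinAt w (P.bicycle (w t) (P.F (w t)) (P.δ (w t))) J t

end RingRoad

end

/-!
Along the closed loop the conservative part of the feedback cancels in the derivative of `H_R`, the
viscosity terms contribute nonpositive sums because `κ` is symmetric and `g₁`, `g₂` are monotone,
and the total interaction torque vanishes by the symmetry of `V`; what remains is at most `-W`,
where `W = ∑ (xᵢ f₁(xᵢ) + yᵢ f₂(yᵢ))` with `xᵢ = vᵢ cos sᵢ / rᵢ - ω*` and `yᵢ = sin sᵢ`. Since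
`H_R` blows up at the boundary of `Ω`, its sublevel sets are closed in `ℝ⁴ⁿ`, and they are compact
modulo full turns of the angles. Hence a smooth cutoff of the vector field above a level of `H_R` is
Lipschitz, which gives global existence and uniqueness, and every `C¹` periodic observable is
uniformly continuous along a solution. So `W → 0`, and Barbalat's lemma gives the limits of `ṡᵢ` and
`Fᵢ`.
-/

noncomputable section

section IntegralCurve

variable {E : Type*} [NormedAddCommGroup E] [NormedSpace ℝ E] {f : E → E} {K : NNReal}

theorem isMIntegralCurve_iff_isIntegralCurve {w : ℝ → E} :
    IsMIntegralCurve (I := modelWithCornersSelf ℝ E) w f ↔ IsIntegralCurve w fun _ ↦ f :=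
  forall_congr' fun _ ↦ hasMFDerivAt_iff_hasFDerivAt

theorem isMIntegralCurveOn_iff_isIntegralCurveOn {w : ℝ → E} {s : Set ℝ} :
    IsMIntegralCurveOn (I := modelWithCornersSelf ℝ E) w f s ↔
      IsIntegralCurveOn w (fun _ ↦ f) s :=
  forall₂_congr fun _ _ ↦ hasMFDerivWithinAt_iff_hasFDerivWithinAt

theorem eqOn_of_isIntegralCurveOn_of_lipschitzWith (hf : LipschitzWith K f) {J : Set ℝ} {a : ℝ}
    (hJ : J.OrdConnected) (ha : a ∈ J) (hJa : J ⊆ Ici a) {w y : ℝ → E}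
    (hw : IsIntegralCurveOn w (fun _ ↦ f) J) (hy : IsIntegralCurveOn y (fun _ ↦ f) J)
    (h : w a = y a) : EqOn w y J := by
  intro t ht
  have hsub : Icc a t ⊆ J := hJ.out ha ht
  have hright : ∀ u ∈ Ico a t, J ∈ 𝓝[Ici u] u := fun u hu ↦
    mem_of_superset (Icc_mem_nhdsGE hu.2) ((Icc_subset_Icc_left hu.1).trans hsub)
  exact ODE_solution_unique (fun _ ↦ hf)
    (hw.continuousOn.mono hsub)
    (fun u hu ↦ (hw u (hsub (Ico_subset_Icc_self hu))).mono_of_mem_nhdsWithin (hright u hu))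
    (hy.continuousOn.mono hsub)
    (fun u hu ↦ (hy u (hsub (Ico_subset_Icc_self hu))).mono_of_mem_nhdsWithin (hright u hu))
    h ⟨hJa ht, le_rfl⟩

variable [CompleteSpace E]

-- On the ball of radius `‖f x₀‖ + 1` the field is at most `(‖f x₀‖ + 1) * (1 + K)`, so the
-- existence time of the Picard-Lindelöf theorem does not depend on `x₀`.
theorem exists_isIntegralCurveOn_Ioo_of_lipschitzWith (hf : LipschitzWith K f) (x₀ : E) :
    ∃ w : ℝ → E, w 0 = x₀ ∧
      IsIntegralCurveOn w (fun _ ↦ f) (Ioo (-(1 + K : ℝ)⁻¹) (1 + K : ℝ)⁻¹) := by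
  set ε : ℝ := (1 + K : ℝ)⁻¹
  have hε : 0 < ε := by positivity
  have hbound : ∀ x ∈ Metric.closedBall x₀ (‖f x₀‖₊ + 1 : NNReal),
      ‖f x‖ ≤ ((‖f x₀‖₊ + 1) * (1 + K) : NNReal) := by
    intro x hx
    have hdist : ‖f x - f x₀‖ ≤ K * (‖f x₀‖ + 1) :=
      (hf.norm_sub_le x x₀).trans (by gcongr; simpa [dist_eq_norm] using hx)
    have htri := norm_le_norm_add_norm_sub' (f x) (f x₀)
    push_cast
    linarith
  obtain ⟨w, h0, hw⟩ := (IsPicardLindelof.of_time_independent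
    (t₀ := (⟨0, by simp [hε.le]⟩ : Icc (-ε) ε)) (r := 0) hbound hf.lipschitzOnWith
    (by simp [ε, mul_assoc, mul_inv_cancel₀ (show (1 + K : ℝ) ≠ 0 by positivity)])
    ).exists_eq_forall_mem_Icc_hasDerivWithinAt₀
  exact ⟨w, h0, IsIntegralCurveOn.mono (v := fun _ ↦ f) hw Ioo_subset_Icc_self⟩

theorem exists_isIntegralCurve_of_lipschitzWith (hf : ContDiff ℝ 1 f) (hK : LipschitzWith K f)
    (x₀ : E) : ∃ w : ℝ → E, w 0 = x₀ ∧ IsIntegralCurve w fun _ ↦ f := by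
  obtain ⟨w, h0, hw⟩ := exists_isMIntegralCurve_of_isMIntegralCurveOn
    (contMDiff_vectorSpace_iff_contDiff.2 hf) (show (0 : ℝ) < (1 + K : ℝ)⁻¹ by positivity)
    (fun x ↦ (exists_isIntegralCurveOn_Ioo_of_lipschitzWith hK x).imp fun _ h ↦
      ⟨h.1, isMIntegralCurveOn_iff_isIntegralCurveOn.2 h.2⟩) x₀
  exact ⟨w, h0, isMIntegralCurve_iff_isIntegralCurve.1 hw⟩

end IntegralCurve

section Barbalat

variable {a : ℝ}

theorem eventually_lt_of_tendsto_of_deriv_le_neg {H H' W : ℝ → ℝ} {l ε : ℝ}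
    (hW : UniformContinuousOn W (Ici a))
    (hH : ∀ t ∈ Ici a, HasDerivWithinAt H (H' t) (Ici a) t)
    (hle : ∀ t ∈ Ici a, H' t ≤ -W t) (hl : Tendsto H atTop (𝓝 l)) (hε : 0 < ε) :
    ∀ᶠ t in atTop, W t < ε := by
  obtain ⟨d, hd, hWd⟩ := Metric.uniformContinuousOn_iff_le.1 hW (ε / 3) (by positivity)
  have hdiff : Tendsto (fun t ↦ (H (t + d) - H t) / d) atTop (𝓝 0) := by
    simpa using ((hl.comp (tendsto_atTop_add_const_right _ d tendsto_id)).sub hl).div_const d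
  filter_upwards [eventually_ge_atTop a,
    hdiff.eventually (lt_mem_nhds (show -(ε / 3) < 0 by linarith))] with t ht hslope
  have hsub : Icc t (t + d) ⊆ Ici a := fun u hu ↦ ht.trans hu.1
  obtain ⟨ξ, hξ, hHξ⟩ := exists_hasDerivAt_eq_slope H H' (lt_add_of_pos_right t hd)
    (fun u hu ↦ ((hH u (hsub hu)).continuousWithinAt).mono hsub)
    (fun u hu ↦ (hH u (ht.trans hu.1.le)).hasDerivAt (Ici_mem_nhds (ht.trans_lt hu.1)))
  rw [add_sub_cancel_left] at hHξ
  have hWξ := hle ξ (ht.trans hξ.1.le)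
  have hclose := hWd t ht ξ (ht.trans hξ.1.le) (by
    rw [Real.dist_eq, abs_le]
    constructor <;> linarith [hξ.1, hξ.2])
  rw [Real.dist_eq] at hclose
  linarith [le_abs_self (W t - W ξ)]

theorem tendsto_deriv_zero_of_tendsto {h h' : ℝ → ℝ} {l : ℝ}
    (hh' : UniformContinuousOn h' (Ici a))
    (hd : ∀ t ∈ Ici a, HasDerivWithinAt h (h' t) (Ici a) t) (hl : Tendsto h atTop (𝓝 l)) :
    Tendsto h' atTop (𝓝 0) := by
  refine tendsto_order.2 ⟨fun ε hε ↦ ?_, fun ε hε ↦ ?_⟩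
  · filter_upwards [eventually_lt_of_tendsto_of_deriv_le_neg
      (uniformContinuous_neg.comp_uniformContinuousOn hh') hd
      (fun t _ ↦ (neg_neg (h' t)).ge) hl (neg_pos.2 hε)] with t ht
    exact neg_lt_neg_iff.1 ht
  · exact eventually_lt_of_tendsto_of_deriv_le_neg hh' (fun t ht ↦ (hd t ht).neg)
      (fun _ _ ↦ le_rfl) hl.neg hε

theorem exists_tendsto_of_antitoneOn_Ici {H : ℝ → ℝ} (hH : AntitoneOn H (Ici a))
    (hbdd : BddBelow (H '' Ici a)) : ∃ l, Tendsto H atTop (𝓝 l) := by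
  have hanti : Antitone fun t ↦ H (max a t) := fun s t hst ↦
    hH (le_max_left a s) (le_max_left a t) (max_le_max_left a hst)
  refine ⟨_, (tendsto_atTop_ciInf hanti (hbdd.mono ?_)).congr' ?_⟩
  · exact range_subset_iff.2 fun t ↦ mem_image_of_mem H (le_max_left a t)
  · filter_upwards [eventually_ge_atTop a] with t ht using by rw [max_eq_right ht]

theorem tendsto_zero_of_dissipation {H H' W : ℝ → ℝ} (hbdd : BddBelow (H '' Ici a))
    (hW : UniformContinuousOn W (Ici a)) (hW0 : ∀ t ∈ Ici a, 0 ≤ W t)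
    (hH : ∀ t ∈ Ici a, HasDerivWithinAt H (H' t) (Ici a) t)
    (hle : ∀ t ∈ Ici a, H' t ≤ -W t) : Tendsto W atTop (𝓝 0) := by
  have hanti : AntitoneOn H (Ici a) :=
    antitoneOn_of_hasDerivWithinAt_nonpos (convex_Ici a)
      (fun t ht ↦ (hH t ht).continuousWithinAt)
      (fun t ht ↦ (hH t (interior_subset ht)).mono interior_subset)
      (fun t ht ↦ (hle t (interior_subset ht)).trans
        (neg_nonpos.2 (hW0 t (interior_subset ht))))
  obtain ⟨l, hl⟩ := exists_tendsto_of_antitoneOn_Ici hanti hbdd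
  refine tendsto_order.2 ⟨fun ε hε ↦ ?_, fun ε hε ↦
    eventually_lt_of_tendsto_of_deriv_le_neg hW hH hle hl hε⟩
  filter_upwards [eventually_ge_atTop a] with t ht using hε.trans_le (hW0 t ht)

end Barbalat

theorem tendsto_of_tendsto_comp_of_isCompact {X Y Z : Type*} [TopologicalSpace X]
    [TopologicalSpace Z] [T2Space Z] {K : Set X} (hK : IsCompact K) {l : Filter Y} {x : Y → X}
    (hx : ∀ᶠ y in l, x y ∈ K) {h : X → Z} (hh : Continuous h) {a : X} {b : Z}
    (hab : ∀ y ∈ K, h y = b → y = a) (hlim : Tendsto (fun y ↦ h (x y)) l (𝓝 b)) :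
    Tendsto x l (𝓝 a) := by
  refine hK.tendsto_nhds_of_unique_mapClusterPt hx fun y hy hcluster ↦ hab y hy ?_
  have : (𝓝 (h y) ⊓ 𝓝 b).NeBot :=
    (hcluster.continuousAt_comp hh.continuousAt).neBot.mono (inf_le_inf_left _ hlim)
  exact eq_of_nhds_neBot this

section Sublevel

variable {E : Type*} {Ω : Set E} {H : E → ℝ} {c : ℝ} {x : E}

/-- The sublevel set at height `c` of a function `H` that is meaningful on `Ω` only. -/
def sublevelOn (Ω : Set E) (H : E → ℝ) (c : ℝ) : Set E :=
  {x ∈ Ω | H x ≤ c}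

theorem sublevelOn_subset : sublevelOn Ω H c ⊆ Ω :=
  sep_subset _ _

theorem sublevelOn_mono : Monotone (sublevelOn Ω H) :=
  fun _ _ h _ hx ↦ ⟨hx.1, hx.2.trans h⟩

theorem isClosed_sublevelOn [TopologicalSpace E] (hH : ContinuousOn H Ω)
    (htop : ∀ x ∈ frontier Ω, Tendsto H (𝓝[Ω] x) atTop) (c : ℝ) :
    IsClosed (sublevelOn Ω H c) := by
  refine isClosed_of_closure_subset fun x hx ↦ ?_
  have hne : (𝓝[sublevelOn Ω H c] x).NeBot := mem_closure_iff_nhdsWithin_neBot.1 hx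
  have hle : 𝓝[sublevelOn Ω H c] x ≤ 𝓝[Ω] x := nhdsWithin_mono x sublevelOn_subset
  have hHc : ∀ᶠ y in 𝓝[sublevelOn Ω H c] x, H y ≤ c :=
    eventually_mem_nhdsWithin.mono fun _ hy ↦ hy.2
  by_cases hxΩ : x ∈ Ω
  · exact ⟨hxΩ, le_of_tendsto ((hH x hxΩ).mono_left hle) hHc⟩
  · have hfr : x ∈ frontier Ω :=
      ⟨closure_mono sublevelOn_subset hx, fun h ↦ hxΩ (interior_subset h)⟩
    obtain ⟨y, hy, hy'⟩ := ((((htop x hfr).mono_left hle).eventually_gt_atTop c).and hHc).exists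
    exact absurd hy' hy.not_ge

end Sublevel

section Cutoff

variable {E F : Type*} [NormedAddCommGroup F] [NormedSpace ℝ F] {Ω : Set E} {H : E → ℝ} {c : ℝ}
  {x : E}

/-- The function `g`, cut off smoothly between the levels `c` and `c + 1` of `H` and extended
by zero outside `Ω`. -/
def cutoff (Ω : Set E) (H : E → ℝ) (c : ℝ) (g : E → F) : E → F :=
  Ω.indicator fun x ↦ Real.smoothTransition (c + 1 - H x) • g x

theorem cutoff_of_mem_sublevelOn {g : E → F} (hx : x ∈ sublevelOn Ω H c) :
    cutoff Ω H c g x = g x := by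
  rw [cutoff, indicator_of_mem hx.1, Real.smoothTransition.one_of_one_le (by linarith [hx.2]),
    one_smul]

theorem cutoff_of_notMem_sublevelOn {g : E → F} (hx : x ∉ sublevelOn Ω H (c + 1)) :
    cutoff Ω H c g x = 0 := by
  refine indicator_apply_eq_zero.2 fun hxΩ ↦ ?_
  have hlt : c + 1 < H x := not_le.1 fun h ↦ hx ⟨hxΩ, h⟩
  rw [Real.smoothTransition.zero_of_nonpos (by linarith), zero_smul]

end Cutoff

section Lyapunov

variable {ι E F : Type*} [NormedAddCommGroup E] [NormedSpace ℝ E]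
  [NormedAddCommGroup F] [NormedSpace ℝ F]
  {τ : ι → E} {Ω : Set E} {H : E → ℝ} {f : E → E} {c : ℝ} {x : E}

theorem periodic_fderiv {g : E → F} {p : E} (hg : g.Periodic p) : (fderiv ℝ g).Periodic p := by
  intro x
  rw [← fderiv_comp_add_right, funext hg]

theorem hasDerivWithinAt_comp_of_isIntegralCurveOn (hΩ : IsOpen Ω) {g : E → F}
    (hg : DifferentiableOn ℝ g Ω) {J : Set ℝ} {w : ℝ → E}
    (hw : IsIntegralCurveOn w (fun _ ↦ f) J) (hmem : MapsTo w J Ω) {t : ℝ} (ht : t ∈ J) :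
    HasDerivWithinAt (g ∘ w) (fderiv ℝ g (w t) (f (w t))) J t :=
  (hg.differentiableAt (hΩ.mem_nhds (hmem ht))).hasFDerivAt.comp_hasDerivWithinAt t (hw t ht)

theorem antitoneOn_comp_of_fderiv_nonpos (hΩ : IsOpen Ω) (hH : DifferentiableOn ℝ H Ω)
    (hf : ∀ x ∈ Ω, fderiv ℝ H x (f x) ≤ 0) {J : Set ℝ} (hJ : J.OrdConnected) {w : ℝ → E}
    (hw : IsIntegralCurveOn w (fun _ ↦ f) J) (hmem : MapsTo w J Ω) : AntitoneOn (H ∘ w) J := by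
  have hd : ∀ t ∈ J, HasDerivWithinAt (H ∘ w) (fderiv ℝ H (w t) (f (w t))) J t := fun _ ↦
    hasDerivWithinAt_comp_of_isIntegralCurveOn hΩ hH hw hmem
  exact antitoneOn_of_hasDerivWithinAt_nonpos hJ.convex
    (fun t ht ↦ (hd t ht).continuousWithinAt)
    (fun t ht ↦ (hd t (interior_subset ht)).mono interior_subset)
    (fun t ht ↦ hf _ (hmem (interior_subset ht)))

theorem mapsTo_sublevelOn_of_fderiv_nonpos (hΩ : IsOpen Ω) (hH : DifferentiableOn ℝ H Ω)
    (hclosed : IsClosed (sublevelOn Ω H c)) (hf : ∀ x ∈ Ω, fderiv ℝ H x (f x) ≤ 0) {w : ℝ → E}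
    (hw : IsIntegralCurve w fun _ ↦ f) (h0 : w 0 ∈ sublevelOn Ω H c) :
    MapsTo w (Ici 0) (sublevelOn Ω H c) := by
  intro T hT
  refine ((hclosed.preimage hw.continuous).inter isClosed_Icc).Icc_subset_of_forall_mem_nhdsWithin
    h0 (fun t ht ↦ ?_) ⟨hT, le_rfl⟩
  obtain ⟨u, htu, hu⟩ : ∃ u > t, Icc t u ⊆ w ⁻¹' Ω :=
    mem_nhdsGE_iff_exists_Icc_subset.1
      (nhdsWithin_le_nhds ((hΩ.preimage hw.continuous).mem_nhds ht.1.1))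
  have hanti := antitoneOn_comp_of_fderiv_nonpos hΩ hH hf ordConnected_Icc
    (hw.isIntegralCurveOn _) hu
  filter_upwards [Ioc_mem_nhdsGT htu] with v hv
  have hv' := Ioc_subset_Icc_self hv
  exact ⟨hu hv', (hanti (left_mem_Icc.2 (le_of_lt htu)) hv' hv.1.le).trans ht.1.2⟩

/-- `H` is a barrier function for the open set `Ω`: it is `C¹` on `Ω` and blows up at the
boundary. The vectors `τ k` are common periods of `Ω` and `H`, and modulo these periods `Ω` is
relatively compact; this replaces compactness of the sublevel sets of `H` for systems, such as
those with angular coordinates, whose natural state space is a quotient of `E`. -/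
structure IsPeriodicBarrier (τ : ι → E) (Ω : Set E) (H : E → ℝ) : Prop where
  isOpen : IsOpen Ω
  contDiffOn : ContDiffOn ℝ 1 H Ω
  tendsto_atTop : ∀ x ∈ frontier Ω, Tendsto H (𝓝[Ω] x) atTop
  add_mem_iff : ∀ k x, x + τ k ∈ Ω ↔ x ∈ Ω
  periodic : ∀ k, H.Periodic (τ k)
  exists_isCompact : ∃ K, IsCompact K ∧ ∀ x ∈ Ω, ∃ k, x + τ k ∈ K

theorem fderiv_cutoff_nonpos (hf : ∀ x ∈ Ω, fderiv ℝ H x (f x) ≤ 0) (hx : x ∈ Ω) :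
    fderiv ℝ H x (cutoff Ω H c f x) ≤ 0 := by
  rw [cutoff, indicator_of_mem hx, map_smul, smul_eq_mul]
  exact mul_nonpos_of_nonneg_of_nonpos (Real.smoothTransition.nonneg _) (hf x hx)

theorem isIntegralCurveOn_cutoff_iff {J : Set ℝ} {w : ℝ → E}
    (hw : MapsTo w J (sublevelOn Ω H c)) :
    IsIntegralCurveOn w (fun _ ↦ cutoff Ω H c f) J ↔ IsIntegralCurveOn w (fun _ ↦ f) J :=
  forall₂_congr fun t ht ↦ by simp only [cutoff_of_mem_sublevelOn (hw ht)]

namespace IsPeriodicBarrier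

theorem isClosed_sublevelOn (h : IsPeriodicBarrier τ Ω H) (c : ℝ) : IsClosed (sublevelOn Ω H c) :=
  _root_.isClosed_sublevelOn h.contDiffOn.continuousOn h.tendsto_atTop c

theorem exists_bound_on_sublevelOn (h : IsPeriodicBarrier τ Ω H) {G : Type*}
    [SeminormedAddCommGroup G] {g : E → G} (hg : ContinuousOn g Ω)
    (hper : ∀ k, g.Periodic (τ k)) (c : ℝ) :
    ∃ C : NNReal, ∀ x ∈ sublevelOn Ω H c, ‖g x‖₊ ≤ C := by
  obtain ⟨K, hK, hcover⟩ := h.exists_isCompact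
  obtain ⟨C, hC⟩ := (hK.inter_left (h.isClosed_sublevelOn c)).exists_bound_of_continuousOn
    (hg.mono (inter_subset_left.trans sublevelOn_subset))
  refine ⟨C.toNNReal, fun x hx ↦ ?_⟩
  obtain ⟨k, hk⟩ := hcover x hx.1
  have hmem : x + τ k ∈ sublevelOn Ω H c :=
    ⟨(h.add_mem_iff k x).2 hx.1, (h.periodic k x).trans_le hx.2⟩
  rw [← hper k x]
  exact (hC _ ⟨hmem, hk⟩).trans (Real.le_coe_toNNReal C)

theorem exists_monotone_norm_le (h : IsPeriodicBarrier τ Ω H) {G : Type*}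
    [SeminormedAddCommGroup G] {g : E → G} (hg : ContinuousOn g Ω)
    (hper : ∀ k, g.Periodic (τ k)) :
    ∃ B : ℝ → ℝ, Monotone B ∧ (∀ c, 0 ≤ B c) ∧ ∀ c, ∀ x ∈ sublevelOn Ω H c, ‖g x‖ ≤ B c := by
  have hbdd (c : ℝ) : BddAbove ((‖g ·‖) '' sublevelOn Ω H c) := by
    obtain ⟨C, hC⟩ := h.exists_bound_on_sublevelOn hg hper c
    exact ⟨C, forall_mem_image.2 hC⟩
  have hnonneg (c : ℝ) : 0 ≤ sSup ((‖g ·‖) '' sublevelOn Ω H c) :=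
    Real.sSup_nonneg (forall_mem_image.2 fun _ _ ↦ norm_nonneg _)
  refine ⟨fun c ↦ sSup ((‖g ·‖) '' sublevelOn Ω H c), fun c d hcd ↦ ?_, hnonneg,
    fun c x hx ↦ le_csSup (hbdd c) (mem_image_of_mem _ hx)⟩
  exact Real.sSup_le (fun y hy ↦ le_csSup (hbdd d) (image_mono (sublevelOn_mono hcd) hy))
    (hnonneg d)

theorem contDiff_cutoff (h : IsPeriodicBarrier τ Ω H) {g : E → F} (hg : ContDiffOn ℝ 1 g Ω) :
    ContDiff ℝ 1 (cutoff Ω H c g) := by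
  refine contDiff_iff_contDiffAt.2 fun x ↦ ?_
  by_cases hx : x ∈ Ω
  · have hΩ := h.isOpen.mem_nhds hx
    have hsmooth : ContDiffAt ℝ 1 (fun x ↦ Real.smoothTransition (c + 1 - H x) • g x) x :=
      (Real.smoothTransition.contDiffAt.comp x
        (contDiffAt_const.sub (h.contDiffOn.contDiffAt hΩ))).smul (hg.contDiffAt hΩ)
    exact hsmooth.congr_of_eventuallyEq (eventually_of_mem hΩ fun y hy ↦ indicator_of_mem hy _)
  · have hzero : (sublevelOn Ω H (c + 1))ᶜ ∈ 𝓝 x :=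
      (h.isClosed_sublevelOn _).isOpen_compl.mem_nhds fun h ↦ hx h.1
    exact contDiffAt_const.congr_of_eventuallyEq
      (eventually_of_mem hzero fun y hy ↦ cutoff_of_notMem_sublevelOn hy)

theorem periodic_cutoff (h : IsPeriodicBarrier τ Ω H) {g : E → F}
    (hper : ∀ k, g.Periodic (τ k)) (k : ι) : (cutoff Ω H c g).Periodic (τ k) := by
  intro x
  by_cases hx : x ∈ Ω
  · simp only [cutoff, indicator_of_mem hx, indicator_of_mem ((h.add_mem_iff k x).2 hx),
      h.periodic k x, hper k x]
  · simp only [cutoff, indicator_of_notMem hx, indicator_of_notMem fun hx' ↦ hx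
      ((h.add_mem_iff k x).1 hx')]

theorem exists_lipschitzWith_cutoff (h : IsPeriodicBarrier τ Ω H) {g : E → F}
    (hg : ContDiffOn ℝ 1 g Ω) (hper : ∀ k, g.Periodic (τ k)) :
    ∃ K, LipschitzWith K (cutoff Ω H c g) := by
  have hsmooth : ContDiff ℝ 1 (cutoff Ω H c g) := h.contDiff_cutoff hg
  obtain ⟨K, hK⟩ := h.exists_bound_on_sublevelOn
    (hsmooth.continuous_fderiv one_ne_zero).continuousOn
    (fun k ↦ periodic_fderiv (h.periodic_cutoff hper k)) (c + 1)
  refine ⟨K, lipschitzWith_of_nnnorm_fderiv_le (hsmooth.differentiable one_ne_zero) fun x ↦ ?_⟩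
  by_cases hx : x ∈ sublevelOn Ω H (c + 1)
  · exact hK x hx
  · have hzero : cutoff Ω H c g =ᶠ[𝓝 x] fun _ ↦ 0 :=
      eventually_of_mem ((h.isClosed_sublevelOn _).isOpen_compl.mem_nhds hx)
        fun _ ↦ cutoff_of_notMem_sublevelOn
    simp [hzero.fderiv_eq]

end IsPeriodicBarrier

/-- `H` is a Lyapunov function of the `C¹` vector field `f` on `Ω` which is at the same time a
barrier function for `Ω`, so that the solutions of `x' = f x` are trapped in the sublevel sets
of `H`. -/
structure IsPeriodicLyapunov (τ : ι → E) (Ω : Set E) (H : E → ℝ) (f : E → E) : Prop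
    extends IsPeriodicBarrier τ Ω H where
  contDiffOn_field : ContDiffOn ℝ 1 f Ω
  periodic_field : ∀ k, f.Periodic (τ k)
  fderiv_nonpos : ∀ x ∈ Ω, fderiv ℝ H x (f x) ≤ 0

namespace IsPeriodicLyapunov

theorem mapsTo_sublevelOn (h : IsPeriodicLyapunov τ Ω H f) {J : Set ℝ} (hJ : J.OrdConnected)
    {a : ℝ} (ha : a ∈ J) (hJa : J ⊆ Ici a) {w : ℝ → E}
    (hw : IsIntegralCurveOn w (fun _ ↦ f) J) (hmem : MapsTo w J Ω) :
    MapsTo w J (sublevelOn Ω H (H (w a))) :=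
  fun _ ht ↦ ⟨hmem ht, antitoneOn_comp_of_fderiv_nonpos h.isOpen
    (h.contDiffOn.differentiableOn one_ne_zero) h.fderiv_nonpos hJ hw hmem ha ht (hJa ht)⟩

theorem eqOn_of_isIntegralCurveOn (h : IsPeriodicLyapunov τ Ω H f) {J : Set ℝ}
    (hJ : J.OrdConnected) {a : ℝ} (ha : a ∈ J) (hJa : J ⊆ Ici a) {w y : ℝ → E}
    (hw : IsIntegralCurveOn w (fun _ ↦ f) J) (hwmem : MapsTo w J Ω)
    (hy : IsIntegralCurveOn y (fun _ ↦ f) J) (hymem : MapsTo y J Ω) (heq : w a = y a) :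
    EqOn w y J := by
  obtain ⟨K, hK⟩ := h.exists_lipschitzWith_cutoff (c := H (w a)) h.contDiffOn_field
    h.periodic_field
  have hwsub := h.mapsTo_sublevelOn hJ ha hJa hw hwmem
  have hysub := h.mapsTo_sublevelOn hJ ha hJa hy hymem
  rw [← heq] at hysub
  exact eqOn_of_isIntegralCurveOn_of_lipschitzWith hK hJ ha hJa
    ((isIntegralCurveOn_cutoff_iff hwsub).2 hw) ((isIntegralCurveOn_cutoff_iff hysub).2 hy) heq

theorem exists_isIntegralCurveOn_Ici [CompleteSpace E] (h : IsPeriodicLyapunov τ Ω H f) {x₀ : E}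
    (hx₀ : x₀ ∈ Ω) :
    ∃ w : ℝ → E, w 0 = x₀ ∧ MapsTo w (Ici 0) Ω ∧ IsIntegralCurveOn w (fun _ ↦ f) (Ici 0) := by
  obtain ⟨K, hK⟩ := h.exists_lipschitzWith_cutoff (c := H x₀) h.contDiffOn_field
    h.periodic_field
  obtain ⟨w, h0, hw⟩ := exists_isIntegralCurve_of_lipschitzWith
    (h.contDiff_cutoff h.contDiffOn_field) hK x₀
  have hsub : MapsTo w (Ici 0) (sublevelOn Ω H (H x₀)) :=
    mapsTo_sublevelOn_of_fderiv_nonpos h.isOpen (h.contDiffOn.differentiableOn one_ne_zero)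
      (h.isClosed_sublevelOn _) (fun _ ↦ fderiv_cutoff_nonpos h.fderiv_nonpos) hw
      (by rw [h0]; exact ⟨hx₀, le_rfl⟩)
  exact ⟨w, h0, hsub.mono_right sublevelOn_subset,
    (isIntegralCurveOn_cutoff_iff hsub).1 (hw.isIntegralCurveOn _)⟩

theorem uniformContinuousOn_comp (h : IsPeriodicLyapunov τ Ω H f) {a : ℝ} {w : ℝ → E}
    (hw : IsIntegralCurveOn w (fun _ ↦ f) (Ici a)) (hmem : MapsTo w (Ici a) Ω) {g : E → F}
    (hg : ContDiffOn ℝ 1 g Ω) (hper : ∀ k, g.Periodic (τ k)) :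
    UniformContinuousOn (g ∘ w) (Ici a) := by
  have hrate : ContinuousOn (fun x ↦ fderiv ℝ g x (f x)) Ω :=
    (hg.continuousOn_fderiv_of_isOpen h.isOpen le_rfl).clm_apply h.contDiffOn_field.continuousOn
  obtain ⟨C, hC⟩ := h.exists_bound_on_sublevelOn hrate
    (fun k x ↦ by simp only [periodic_fderiv (hper k) x, h.periodic_field k x]) (H (w a))
  have hsub := h.mapsTo_sublevelOn ordConnected_Ici self_mem_Ici le_rfl hw hmem
  exact ((convex_Ici a).lipschitzOnWith_of_nnnorm_hasDerivWithin_le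
    (fun _ ↦ hasDerivWithinAt_comp_of_isIntegralCurveOn h.isOpen
      (hg.differentiableOn one_ne_zero) hw hmem)
    fun t ht ↦ hC _ (hsub ht)).uniformContinuousOn

theorem tendsto_zero_of_fderiv_le_neg (h : IsPeriodicLyapunov τ Ω H f) {a : ℝ} {w : ℝ → E}
    (hw : IsIntegralCurveOn w (fun _ ↦ f) (Ici a)) (hmem : MapsTo w (Ici a) Ω) {W : E → ℝ}
    (hW : ContDiffOn ℝ 1 W Ω) (hper : ∀ k, W.Periodic (τ k)) (hW0 : ∀ x ∈ Ω, 0 ≤ W x)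
    (hle : ∀ x ∈ Ω, fderiv ℝ H x (f x) ≤ -W x) : Tendsto (W ∘ w) atTop (𝓝 0) := by
  obtain ⟨C, hC⟩ := h.exists_bound_on_sublevelOn h.contDiffOn.continuousOn h.periodic (H (w a))
  have hsub := h.mapsTo_sublevelOn ordConnected_Ici self_mem_Ici le_rfl hw hmem
  have hbdd : BddBelow (H ∘ w '' Ici a) :=
    ⟨-C, forall_mem_image.2 fun t ht ↦ (abs_le.1 (hC _ (hsub ht))).1⟩
  exact tendsto_zero_of_dissipation hbdd (h.uniformContinuousOn_comp hw hmem hW hper)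
    (fun t ht ↦ hW0 _ (hmem ht))
    (fun _ ↦ hasDerivWithinAt_comp_of_isIntegralCurveOn h.isOpen
      (h.contDiffOn.differentiableOn one_ne_zero) hw hmem)
    fun t ht ↦ hle _ (hmem ht)

end IsPeriodicLyapunov

end Lyapunov

section OffDiagonalSums

open Finset

variable {ι : Type*} [Fintype ι] [DecidableEq ι]

theorem sum_erase_comm {M : Type*} [AddCommMonoid M] (f : ι → ι → M) :
    ∑ i, ∑ j ∈ univ.erase i, f i j = ∑ i, ∑ j ∈ univ.erase i, f j i :=
  sum_comm' fun i j ↦ by simp [eq_comm]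

theorem half_sum_erase_eq_of_eq_add_swap {f g : ι → ι → ℝ}
    (h : ∀ i j, j ≠ i → f i j = g i j + g j i) :
    1 / 2 * ∑ i, ∑ j ∈ univ.erase i, f i j = ∑ i, ∑ j ∈ univ.erase i, g i j := by
  have hsum : ∑ i, ∑ j ∈ univ.erase i, f i j
      = ∑ i, ∑ j ∈ univ.erase i, g i j + ∑ i, ∑ j ∈ univ.erase i, g j i := by
    simp only [← sum_add_distrib]
    exact sum_congr rfl fun i _ ↦ sum_congr rfl fun j hj ↦ h i j (ne_of_mem_erase hj)
  rw [hsum, ← sum_erase_comm g]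
  ring

theorem sum_erase_eq_zero_of_antisymm {f : ι → ι → ℝ} (h : ∀ i j, j ≠ i → f i j = -f j i) :
    ∑ i, ∑ j ∈ univ.erase i, f i j = 0 := by
  rw [← half_sum_erase_eq_of_eq_add_swap (f := fun _ _ ↦ (0 : ℝ))
    fun i j hij ↦ by rw [h i j hij]; ring]
  simp only [sum_const_zero, mul_zero]

theorem sum_erase_mul_sub_nonpos_of_monovary {k : ι → ι → ℝ} {x y : ι → ℝ} (hxy : Monovary x y)
    (hk : ∀ i j, j ≠ i → 0 ≤ k i j) (hk' : ∀ i j, j ≠ i → k i j = k j i) :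
    ∑ i, ∑ j ∈ univ.erase i, x i * (k i j * (y j - y i)) ≤ 0 := by
  rw [← half_sum_erase_eq_of_eq_add_swap (f := fun i j ↦ -(k i j * ((x j - x i) * (y j - y i))))
    fun i j hij ↦ by rw [hk' j i hij.symm]; ring]
  refine mul_nonpos_of_nonneg_of_nonpos (by norm_num) <|
    sum_nonpos fun i _ ↦ sum_nonpos fun j hj ↦ neg_nonpos.2 ?_
  exact mul_nonneg (hk i j (ne_of_mem_erase hj)) (monovary_iff_forall_mul_nonneg.1 hxy i j)

end OffDiagonalSums

namespace State

variable {n : ℕ}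

@[fun_prop]
theorem contDiff_r {m : WithTop ℕ∞} (i : Fin n) : ContDiff ℝ m (fun w : State n ↦ w.r i) := by
  unfold r; fun_prop

@[fun_prop]
theorem contDiff_φ {m : WithTop ℕ∞} (i : Fin n) : ContDiff ℝ m (fun w : State n ↦ w.φ i) := by
  unfold φ; fun_prop

@[fun_prop]
theorem contDiff_s {m : WithTop ℕ∞} (i : Fin n) : ContDiff ℝ m (fun w : State n ↦ w.s i) := by
  unfold s; fun_prop

@[fun_prop]
theorem contDiff_v {m : WithTop ℕ∞} (i : Fin n) : ContDiff ℝ m (fun w : State n ↦ w.v i) := by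
  unfold v; fun_prop

@[fun_prop]
theorem continuous_r (i : Fin n) : Continuous (fun w : State n ↦ w.r i) :=
  (contDiff_r (m := 0) i).continuous

@[fun_prop]
theorem continuous_φ (i : Fin n) : Continuous (fun w : State n ↦ w.φ i) :=
  (contDiff_φ (m := 0) i).continuous

@[fun_prop]
theorem continuous_s (i : Fin n) : Continuous (fun w : State n ↦ w.s i) :=
  (contDiff_s (m := 0) i).continuous

@[fun_prop]
theorem continuous_v (i : Fin n) : Continuous (fun w : State n ↦ w.v i) :=
  (contDiff_v (m := 0) i).continuous

variable {w : ℝ → State n} {w' : State n} {J : Set ℝ} {t : ℝ}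

theorem hasDerivWithinAt_r (hw : HasDerivWithinAt w w' J t) (i : Fin n) :
    HasDerivWithinAt (fun t ↦ (w t).r i) (w'.r i) J t :=
  hasDerivWithinAt_pi.1 hw.fst i

theorem hasDerivWithinAt_s (hw : HasDerivWithinAt w w' J t) (i : Fin n) :
    HasDerivWithinAt (fun t ↦ (w t).s i) (w'.s i) J t :=
  hasDerivWithinAt_pi.1 hw.snd.snd.fst i

theorem hasDerivWithinAt_v (hw : HasDerivWithinAt w w' J t) (i : Fin n) :
    HasDerivWithinAt (fun t ↦ (w t).v i) (w'.v i) J t :=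
  hasDerivWithinAt_pi.1 hw.snd.snd.snd i

end State

namespace RingRoad

variable {n : ℕ} {P : RingRoad n} {w : State n}

/-- The standing assumptions on the road, the vehicles and the design parameters when the vehicles
may interact at arbitrary distances and the weights `p i j` are arbitrary. -/
structure IsLongRangeAdmissible (P : RingRoad n) : Prop where
  Rin_pos : 0 < P.Rin
  vmax_pos : 0 < P.vmax
  ω_pos : 0 < P.ω
  Θ_pos : 0 < P.Θ
  Θ_lt : P.Θ < Real.pi / 2
  cos_Θ : P.Rout * P.ω / P.vmax < Real.cos P.Θ
  σ_pos : ∀ i, 0 < P.σ i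
  p_symm : ∀ i j, P.p i j = P.p j i
  L_pos : ∀ i j, i ≠ j → 0 < P.L i j
  V_contDiffOn : ∀ i j, i ≠ j → ContDiffOn ℝ 2 (P.V i j) (Ioi (P.L i j))
  V_nonneg : ∀ i j, i ≠ j → ∀ d, P.L i j < d → 0 ≤ P.V i j d
  V_tendsto : ∀ i j, i ≠ j → Tendsto (P.V i j) (𝓝[>] (P.L i j)) atTop
  V_symm : ∀ i j, i ≠ j → ∀ d, P.L i j < d → P.V i j d = P.V j i d
  U_contDiffOn : ∀ i, ContDiffOn ℝ 2 (P.U i) (Ioo P.Rin P.Rout)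
  U_nonneg : ∀ i, ∀ x ∈ Ioo P.Rin P.Rout, 0 ≤ P.U i x
  U_tendsto_Rin : ∀ i, Tendsto (P.U i) (𝓝[>] P.Rin) atTop
  U_tendsto_Rout : ∀ i, Tendsto (P.U i) (𝓝[<] P.Rout) atTop
  κ_contDiffOn : ∀ i j, i ≠ j → ContDiffOn ℝ 1 (P.κ i j) (Ioi (P.L i j))
  κ_nonneg : ∀ i j, i ≠ j → ∀ d, P.L i j < d → 0 ≤ P.κ i j d
  κ_symm : ∀ i j, i ≠ j → ∀ d, P.L i j < d → P.κ i j d = P.κ j i d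
  A_pos : 0 < P.A
  b_gt : 1 / P.Rin ^ 2 < P.b
  g₁_contDiff : ContDiff ℝ 1 P.g₁
  g₁_mono : Monotone P.g₁
  g₂_contDiff : ContDiff ℝ 1 P.g₂
  g₂_mono : Monotone P.g₂
  f₁_contDiff : ContDiff ℝ 1 P.f₁
  f₁_sign : ∀ x, x ≠ 0 → 0 < x * P.f₁ x
  f₂_contDiff : ContDiff ℝ 1 P.f₂
  f₂_sign : ∀ x, x ≠ 0 → 0 < x * P.f₂ x

theorem IsAdmissible.isLongRangeAdmissible (hP : P.IsAdmissible) : P.IsLongRangeAdmissible where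
  __ := hP

/-- The angular speed error of vehicle `i`. -/
def err (P : RingRoad n) (w : State n) (i : Fin n) : ℝ :=
  w.v i / w.r i * Real.cos (w.s i) - P.ω

/-- The closed-loop vector field. -/
def field (P : RingRoad n) (w : State n) : State n := P.bicycle w (P.F w) (P.δ w)

theorem isSolutionOn_iff {w₀ : State n} {J : Set ℝ} {w : ℝ → State n} :
    P.IsSolutionOn w₀ J w ↔ w 0 = w₀ ∧ MapsTo w J P.Ω ∧ IsIntegralCurveOn w (fun _ ↦ P.field) J :=
  ⟨fun h ↦ ⟨h.init, h.mem, h.deriv⟩, fun h ↦ ⟨h.1, h.2.1, h.2.2⟩⟩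

theorem continuous_dist (P : RingRoad n) (i j : Fin n) :
    Continuous (fun w : State n ↦ P.dist w i j) := by
  unfold dist; fun_prop

theorem isOpen_Ω (P : RingRoad n) : IsOpen P.Ω := by
  simp only [Ω, ofPred_and, ofPred_forall]
  refine IsOpen.inter (isOpen_iInter_of_finite fun i ↦ isOpen_Ioo.preimage (by fun_prop)) <|
    IsOpen.inter (isOpen_iInter_of_finite fun i ↦ isOpen_Ioo.preimage (by fun_prop)) <|
    IsOpen.inter (isOpen_iInter_of_finite fun i ↦ isOpen_Ioo.preimage (by fun_prop)) <|
    isOpen_iInter_of_finite fun i ↦ isOpen_iInter_of_finite fun j ↦ isOpen_iInter_of_finite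
      fun _ ↦ isOpen_lt continuous_const (P.continuous_dist i j)

theorem vmax_sub_v_pos (hw : w ∈ P.Ω) (i : Fin n) : 0 < P.vmax - w.v i :=
  sub_pos.2 (hw.2.2.1 i).2

theorem mapsTo_dist {i j : Fin n} (hij : j ≠ i) :
    MapsTo (fun w : State n ↦ P.dist w i j) P.Ω (Ioi (P.L i j)) :=
  fun _ hw ↦ hw.2.2.2 i j hij

/-- Twice the pseudo-relativistic kinetic energy of a vehicle in state `(r, s, v)`. -/
def kinetic (P : RingRoad n) (r s v : ℝ) : ℝ :=
  ((v / r * Real.cos s - P.ω) ^ 2 + P.b * v ^ 2 * Real.sin s ^ 2) / ((P.vmax - v) * v)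

/-- The penalty, blowing up at `s = ± P.Θ`, on the relative orientation `s` of a vehicle. -/
def orientationPenalty (P : RingRoad n) (s : ℝ) : ℝ :=
  1 / (Real.cos s - Real.cos P.Θ) - 1 / (1 - Real.cos P.Θ)

theorem HR_eq (P : RingRoad n) (w : State n) :
    P.HR w = 1 / 2 * ∑ i, P.kinetic (w.r i) (w.s i) (w.v i) + ∑ i, P.U i (w.r i)
      + 1 / 2 * ∑ i, ∑ j ∈ Finset.univ.erase i, P.V i j (P.dist w i j)
      + P.A * ∑ i, P.orientationPenalty (w.s i) :=
  rfl

namespace IsLongRangeAdmissible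

theorem r_pos (hP : P.IsLongRangeAdmissible) (hw : w ∈ P.Ω) (i : Fin n) : 0 < w.r i :=
  hP.Rin_pos.trans (hw.1 i).1

theorem Rout_mul_ω_lt (hP : P.IsLongRangeAdmissible) : P.Rout * P.ω < P.vmax * Real.cos P.Θ :=
  (div_lt_iff₀' hP.vmax_pos).1 hP.cos_Θ

theorem cos_Θ_pos (hP : P.IsLongRangeAdmissible) : 0 < Real.cos P.Θ :=
  Real.cos_pos_of_mem_Ioo ⟨by linarith [hP.Θ_pos, Real.pi_pos], hP.Θ_lt⟩

theorem cos_s_sub_pos (hP : P.IsLongRangeAdmissible) (hw : w ∈ P.Ω) (i : Fin n) :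
    0 < Real.cos (w.s i) - Real.cos P.Θ := by
  rw [sub_pos, ← Real.cos_abs (w.s i)]
  exact Real.cos_lt_cos_of_nonneg_of_le_pi (abs_nonneg _)
    (by linarith [hP.Θ_lt, Real.pi_pos]) (abs_lt.2 (hw.2.1 i))

theorem cos_s_pos (hP : P.IsLongRangeAdmissible) (hw : w ∈ P.Ω) (i : Fin n) :
    0 < Real.cos (w.s i) := by
  linarith [hP.cos_s_sub_pos hw i, hP.cos_Θ_pos]

theorem dist_pos (hP : P.IsLongRangeAdmissible) (hw : w ∈ P.Ω) {i j : Fin n} (hij : j ≠ i) :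
    0 < P.dist w i j :=
  (hP.L_pos i j hij.symm).trans (hw.2.2.2 i j hij)

theorem dist_comm (hP : P.IsLongRangeAdmissible) (w : State n) (i j : Fin n) :
    P.dist w i j = P.dist w j i := by
  unfold dist
  rw [hP.p_symm i j, ← Real.cos_neg (w.φ i - w.φ j), neg_sub]
  ring_nf

theorem q_pos (hP : P.IsLongRangeAdmissible) (hw : w ∈ P.Ω) (i : Fin n) :
    0 < P.q (w.r i) (w.s i) (w.v i) := by
  have hr := hP.r_pos hw i
  have hv := (hw.2.2.1 i).1
  have hv' := vmax_sub_v_pos hw i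
  have hω : w.r i * P.ω < P.vmax * Real.cos (w.s i) := by
    nlinarith [hP.Rout_mul_ω_lt, hP.cos_s_sub_pos hw i, hP.vmax_pos, hP.ω_pos, (hw.1 i).2]
  -- The numerator is `v * (vmax * cos s - r * ω) + r * ω * (vmax - v)`.
  have hnum := add_pos (mul_pos hv (sub_pos.2 hω)) (mul_pos (mul_pos hr hP.ω_pos) hv')
  unfold q
  exact div_pos (by linarith) (by positivity)

theorem γ_pos (hP : P.IsLongRangeAdmissible) (hw : w ∈ P.Ω) (i : Fin n) :
    0 < P.γ (w.r i) (w.s i) (w.v i) := by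
  have := hP.r_pos hw i
  have := (hw.2.2.1 i).1
  have := vmax_sub_v_pos hw i
  have := hP.cos_s_pos hw i
  have := hP.cos_s_sub_pos hw i
  have := hP.A_pos
  have := hP.ω_pos
  have hb : 0 < P.b - 1 / w.r i ^ 2 := by
    have : 1 / w.r i ^ 2 ≤ 1 / P.Rin ^ 2 := one_div_le_one_div_of_le (pow_pos hP.Rin_pos 2)
      (pow_le_pow_left₀ hP.Rin_pos.le (hw.1 i).1.le 2)
    linarith [hP.b_gt]
  unfold γ
  positivity

theorem contDiffOn_dist (hP : P.IsLongRangeAdmissible) {i j : Fin n} (hij : j ≠ i) :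
    ContDiffOn ℝ 1 (fun w : State n ↦ P.dist w i j) P.Ω := by
  unfold dist
  exact ContDiffOn.sqrt (by fun_prop) fun w hw ↦ (Real.sqrt_pos.1 (hP.dist_pos hw hij)).ne'

theorem contDiffOn_V (hP : P.IsLongRangeAdmissible) {i j : Fin n} (hij : j ≠ i) :
    ContDiffOn ℝ 1 (fun w : State n ↦ P.V i j (P.dist w i j)) P.Ω :=
  ((hP.V_contDiffOn i j hij.symm).of_le (by norm_num)).comp (hP.contDiffOn_dist hij)
    (mapsTo_dist hij)

theorem contDiffOn_deriv_V (hP : P.IsLongRangeAdmissible) {i j : Fin n} (hij : j ≠ i) :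
    ContDiffOn ℝ 1 (fun w : State n ↦ deriv (P.V i j) (P.dist w i j)) P.Ω :=
  ((hP.V_contDiffOn i j hij.symm).deriv_of_isOpen isOpen_Ioi (by norm_num)).comp
    (hP.contDiffOn_dist hij) (mapsTo_dist hij)

theorem contDiffOn_κ (hP : P.IsLongRangeAdmissible) {i j : Fin n} (hij : j ≠ i) :
    ContDiffOn ℝ 1 (fun w : State n ↦ P.κ i j (P.dist w i j)) P.Ω :=
  (hP.κ_contDiffOn i j hij.symm).comp (hP.contDiffOn_dist hij) (mapsTo_dist hij)

theorem contDiffOn_U (hP : P.IsLongRangeAdmissible) (i : Fin n) :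
    ContDiffOn ℝ 1 (fun w : State n ↦ P.U i (w.r i)) P.Ω :=
  ((hP.U_contDiffOn i).of_le (by norm_num)).comp (by fun_prop) fun _ hw ↦ hw.1 i

theorem contDiffOn_deriv_U (hP : P.IsLongRangeAdmissible) (i : Fin n) :
    ContDiffOn ℝ 1 (fun w : State n ↦ deriv (P.U i) (w.r i)) P.Ω :=
  ((hP.U_contDiffOn i).deriv_of_isOpen isOpen_Ioo (by norm_num)).comp (by fun_prop)
    fun _ hw ↦ hw.1 i

theorem contDiffOn_angularSpeed (hP : P.IsLongRangeAdmissible) (i : Fin n) :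
    ContDiffOn ℝ 1 (fun w : State n ↦ w.v i / w.r i * Real.cos (w.s i)) P.Ω :=
  (ContDiffOn.div (by fun_prop) (by fun_prop) fun _ hw ↦ (hP.r_pos hw i).ne').mul (by fun_prop)

theorem contDiffOn_err (hP : P.IsLongRangeAdmissible) (i : Fin n) :
    ContDiffOn ℝ 1 (fun w : State n ↦ P.err w i) P.Ω :=
  (hP.contDiffOn_angularSpeed i).sub contDiffOn_const

theorem contDiffOn_kinetic (hP : P.IsLongRangeAdmissible) (i : Fin n) :
    ContDiffOn ℝ 1 (fun w : State n ↦ P.kinetic (w.r i) (w.s i) (w.v i)) P.Ω := by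
  unfold kinetic
  exact (((hP.contDiffOn_err i).pow 2).add (by fun_prop)).div (by fun_prop)
    fun _ hw ↦ (mul_pos (vmax_sub_v_pos hw i) (hw.2.2.1 i).1).ne'

theorem contDiffOn_orientationPenalty (hP : P.IsLongRangeAdmissible) (i : Fin n) :
    ContDiffOn ℝ 1 (fun w : State n ↦ P.orientationPenalty (w.s i)) P.Ω := by
  unfold orientationPenalty
  exact (ContDiffOn.div (by fun_prop) (by fun_prop) fun _ hw ↦ (hP.cos_s_sub_pos hw i).ne').sub
    contDiffOn_const

theorem contDiffOn_HR (hP : P.IsLongRangeAdmissible) : ContDiffOn ℝ 1 P.HR P.Ω := by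
  have hV : ContDiffOn ℝ 1
      (fun w ↦ ∑ i, ∑ j ∈ Finset.univ.erase i, P.V i j (P.dist w i j)) P.Ω :=
    ContDiffOn.sum fun i _ ↦ ContDiffOn.sum fun j hj ↦
      hP.contDiffOn_V (Finset.ne_of_mem_erase hj)
  exact (((contDiffOn_const.mul (ContDiffOn.sum fun i _ ↦ hP.contDiffOn_kinetic i)).add
    (ContDiffOn.sum fun i _ ↦ hP.contDiffOn_U i)).add (contDiffOn_const.mul hV)).add
    (contDiffOn_const.mul (ContDiffOn.sum fun i _ ↦ hP.contDiffOn_orientationPenalty i))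

theorem contDiffOn_Φ (hP : P.IsLongRangeAdmissible) (i : Fin n) :
    ContDiffOn ℝ 1 (fun w ↦ P.Φ w i) P.Ω := by
  unfold Φ
  refine ContDiffOn.mul (by fun_prop) (ContDiffOn.sum fun j hj ↦ ?_)
  have hij := Finset.ne_of_mem_erase hj
  exact (hP.contDiffOn_deriv_V hij).mul (ContDiffOn.div (by fun_prop) (hP.contDiffOn_dist hij)
    fun w hw ↦ (hP.dist_pos hw hij).ne')

theorem contDiffOn_G (hP : P.IsLongRangeAdmissible) (i : Fin n) :
    ContDiffOn ℝ 1 (fun w ↦ P.G w i) P.Ω := by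
  unfold G
  refine ContDiffOn.mul (by fun_prop) (ContDiffOn.sum fun j hj ↦ ?_)
  exact (hP.contDiffOn_κ (Finset.ne_of_mem_erase hj)).mul
    ((hP.g₁_contDiff.comp_contDiffOn (hP.contDiffOn_angularSpeed j)).sub
      (hP.g₁_contDiff.comp_contDiffOn (hP.contDiffOn_angularSpeed i)))

theorem contDiffOn_M (hP : P.IsLongRangeAdmissible) (i : Fin n) :
    ContDiffOn ℝ 1 (fun w ↦ P.M w i) P.Ω := by
  unfold M
  refine ContDiffOn.sum fun j hj ↦ ?_
  exact (hP.contDiffOn_κ (Finset.ne_of_mem_erase hj)).mul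
    ((hP.g₂_contDiff.comp_contDiffOn (by fun_prop)).sub
      (hP.g₂_contDiff.comp_contDiffOn (by fun_prop)))

theorem contDiffOn_q (hP : P.IsLongRangeAdmissible) (i : Fin n) :
    ContDiffOn ℝ 1 (fun w : State n ↦ P.q (w.r i) (w.s i) (w.v i)) P.Ω := by
  unfold q
  refine ContDiffOn.div (by fun_prop) (by fun_prop) fun w hw ↦ ?_
  have := hP.r_pos hw i
  have := (hw.2.2.1 i).1
  have := vmax_sub_v_pos hw i
  positivity

theorem contDiffOn_γ (hP : P.IsLongRangeAdmissible) (i : Fin n) :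
    ContDiffOn ℝ 1 (fun w : State n ↦ P.γ (w.r i) (w.s i) (w.v i)) P.Ω := by
  unfold γ
  have hv : ∀ w ∈ P.Ω, P.vmax - w.v i ≠ 0 := fun w hw ↦ (vmax_sub_v_pos hw i).ne'
  have hr : ∀ w ∈ P.Ω, w.r i ≠ 0 := fun w hw ↦ (hP.r_pos hw i).ne'
  refine ContDiffOn.add (ContDiffOn.add ?_ (ContDiffOn.mul ?_ (ContDiffOn.sub contDiffOn_const ?_)))
    ?_
  · exact ContDiffOn.div (by fun_prop) (by fun_prop)
      fun w hw ↦ pow_ne_zero 2 (hP.cos_s_sub_pos hw i).ne'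
  · exact ContDiffOn.div (by fun_prop) (by fun_prop) hv
  · exact ContDiffOn.div (by fun_prop) (by fun_prop) fun w hw ↦ pow_ne_zero 2 (hr w hw)
  · exact ContDiffOn.div (by fun_prop) (by fun_prop) fun w hw ↦ mul_ne_zero (hr w hw) (hv w hw)

theorem contDiffOn_ζ (i : Fin n) :
    ContDiffOn ℝ 1 (fun w : State n ↦ P.ζ (w.s i) (w.v i)) P.Ω := by
  unfold ζ
  refine ContDiffOn.div (by fun_prop) (by fun_prop) fun w hw ↦ ?_
  have := (hw.2.2.1 i).1
  have := vmax_sub_v_pos hw i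
  positivity

theorem contDiffOn_Z (hP : P.IsLongRangeAdmissible) (i : Fin n) :
    ContDiffOn ℝ 1 (fun w ↦ P.Z w i) P.Ω := by
  unfold Z
  refine ContDiffOn.sub (ContDiffOn.sub (ContDiffOn.mul (hP.contDiffOn_err i) ?_)
    (hP.contDiffOn_deriv_U i)) (ContDiffOn.sum fun j hj ↦ ?_)
  · refine ContDiffOn.div (by fun_prop) (by fun_prop) fun w hw ↦ ?_
    exact mul_ne_zero (vmax_sub_v_pos hw i).ne' (pow_ne_zero 2 (hP.r_pos hw i).ne')
  · have hij := Finset.ne_of_mem_erase hj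
    exact ContDiffOn.mul (by fun_prop) ((hP.contDiffOn_deriv_V hij).div (hP.contDiffOn_dist hij)
      fun w hw ↦ (hP.dist_pos hw hij).ne')

theorem contDiffOn_F (hP : P.IsLongRangeAdmissible) (i : Fin n) :
    ContDiffOn ℝ 1 (fun w ↦ P.F w i) P.Ω := by
  unfold F
  refine ContDiffOn.mul (ContDiffOn.neg (ContDiffOn.div contDiffOn_const (hP.contDiffOn_q i)
    fun w hw ↦ (hP.q_pos hw i).ne')) (ContDiffOn.add ?_ ?_)
  · exact hP.f₁_contDiff.comp_contDiffOn (hP.contDiffOn_err i)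
  · exact contDiffOn_const.mul ((hP.contDiffOn_Φ i).sub (hP.contDiffOn_G i))

theorem contDiffOn_tan_δ (hP : P.IsLongRangeAdmissible) (i : Fin n) :
    ContDiffOn ℝ 1 (fun w ↦ Real.tan (P.δ w i)) P.Ω := by
  simp only [δ, Real.tan_arctan]
  have hr : ∀ w ∈ P.Ω, w.r i ≠ 0 := fun w hw ↦ (hP.r_pos hw i).ne'
  refine ContDiffOn.sub (ContDiffOn.mul (ContDiffOn.div contDiffOn_const (by fun_prop) hr)
    (by fun_prop)) (ContDiffOn.mul (ContDiffOn.div contDiffOn_const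
      ((hP.contDiffOn_γ i).mul (by fun_prop)) fun w hw ↦ ?_)
      (ContDiffOn.sub (ContDiffOn.add ?_ (ContDiffOn.mul (ContDiffOn.add ?_ ?_) ?_)) ?_))
  · exact mul_ne_zero (hP.γ_pos hw i).ne' (hw.2.2.1 i).1.ne'
  · exact hP.f₂_contDiff.comp_contDiffOn (by fun_prop)
  · exact (contDiffOn_ζ i).mul (hP.contDiffOn_F i)
  · exact hP.contDiffOn_Z i
  · fun_prop
  · exact hP.contDiffOn_M i

theorem contDiffOn_δ (hP : P.IsLongRangeAdmissible) (i : Fin n) :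
    ContDiffOn ℝ 1 (fun w ↦ P.δ w i) P.Ω := by
  refine (Real.contDiff_arctan.comp_contDiffOn (hP.contDiffOn_tan_δ i)).congr fun w _ ↦ ?_
  simp [δ, Real.tan_arctan]

theorem contDiffOn_field (hP : P.IsLongRangeAdmissible) : ContDiffOn ℝ 1 P.field P.Ω := by
  unfold field bicycle
  refine ContDiffOn.prodMk (contDiffOn_pi.2 fun i ↦ by fun_prop) <|
    ContDiffOn.prodMk (contDiffOn_pi.2 fun i ↦ hP.contDiffOn_angularSpeed i) <|
    ContDiffOn.prodMk (contDiffOn_pi.2 fun i ↦ ?_) (contDiffOn_pi.2 fun i ↦ hP.contDiffOn_F i)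
  exact (ContDiffOn.mul (by fun_prop) (hP.contDiffOn_tan_δ i)).sub (hP.contDiffOn_angularSpeed i)

theorem hasDerivAt_U (hP : P.IsLongRangeAdmissible) {i : Fin n} {x : ℝ}
    (hx : x ∈ Ioo P.Rin P.Rout) : HasDerivAt (P.U i) (deriv (P.U i) x) x :=
  (((hP.U_contDiffOn i).differentiableOn (by norm_num)).differentiableAt
    (isOpen_Ioo.mem_nhds hx)).hasDerivAt

theorem hasDerivAt_V (hP : P.IsLongRangeAdmissible) {i j : Fin n} (hij : j ≠ i) {d : ℝ}
    (hd : P.L i j < d) : HasDerivAt (P.V i j) (deriv (P.V i j) d) d :=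
  (((hP.V_contDiffOn i j hij.symm).differentiableOn (by norm_num)).differentiableAt
    (isOpen_Ioi.mem_nhds hd)).hasDerivAt

theorem deriv_V_comm (hP : P.IsLongRangeAdmissible) (hw : w ∈ P.Ω) {i j : Fin n} (hij : j ≠ i) :
    deriv (P.V i j) (P.dist w i j) = deriv (P.V j i) (P.dist w j i) := by
  rw [← hP.dist_comm w i j]
  refine Filter.EventuallyEq.deriv_eq ?_
  filter_upwards [isOpen_Ioi.mem_nhds (hw.2.2.2 i j hij)] with d hd using
    hP.V_symm i j hij.symm d hd

theorem κ_dist_comm (hP : P.IsLongRangeAdmissible) (hw : w ∈ P.Ω) {i j : Fin n} (hij : j ≠ i) :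
    P.κ i j (P.dist w i j) = P.κ j i (P.dist w j i) := by
  rw [← hP.dist_comm w i j]
  exact hP.κ_symm i j hij.symm _ (hw.2.2.2 i j hij)

end IsLongRangeAdmissible

theorem hasDerivAt_kinetic {r s v : ℝ → ℝ} {r' s' v' t : ℝ} (hr : HasDerivAt r r' t)
    (hs : HasDerivAt s s' t) (hv : HasDerivAt v v' t) (hr0 : r t ≠ 0) (hv0 : v t ≠ 0)
    (hv1 : P.vmax - v t ≠ 0) :
    HasDerivAt (fun τ ↦ P.kinetic (r τ) (s τ) (v τ))
      (2 * (((v t / r t * Real.cos (s t) - P.ω) * P.q (r t) (s t) (v t)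
          + v t * Real.sin (s t) * P.ζ (s t) (v t)) * v'
        + Real.sin (s t) * (v t * Real.cos (s t) / (P.vmax - v t) * (P.b - 1 / r t ^ 2)
          + P.ω / (r t * (P.vmax - v t))) * s'
        - (v t / r t * Real.cos (s t) - P.ω)
          * (Real.cos (s t) / ((P.vmax - v t) * r t ^ 2)) * r')) t := by
  have h := (((((hv.div hr hr0).mul hs.cos).sub_const P.ω).pow 2).add
    (((hv.pow 2).const_mul P.b).mul (hs.sin.pow 2))).div ((hv.const_sub P.vmax).mul hv)
    (mul_ne_zero hv1 hv0)
  refine h.congr_deriv ?_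
  simp only [q, ζ, Pi.add_apply, Pi.mul_apply, Pi.div_apply, Pi.pow_apply, Nat.reduceSub, pow_one,
    Nat.cast_ofNat]
  field_simp
  ring

theorem hasDerivAt_orientationPenalty {s : ℝ → ℝ} {s' t : ℝ} (hs : HasDerivAt s s' t)
    (h0 : Real.cos (s t) - Real.cos P.Θ ≠ 0) :
    HasDerivAt (fun τ ↦ P.orientationPenalty (s τ))
      (Real.sin (s t) * (1 / (Real.cos (s t) - Real.cos P.Θ) ^ 2) * s') t := by
  have h := ((hasDerivAt_const t (1 : ℝ)).div (hs.cos.sub_const (Real.cos P.Θ)) h0).sub_const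
    (1 / (1 - Real.cos P.Θ))
  refine h.congr_deriv ?_
  field_simp
  ring

theorem hasDerivAt_dist {w : ℝ → State n} {u : State n} {t : ℝ} (hu : HasDerivAt w u t)
    {i j : Fin n} (hd : 0 < P.dist (w t) i j) :
    HasDerivAt (fun τ ↦ P.dist (w τ) i j)
      (((P.p i j * ((w t).r i - (w t).r j)
            + (w t).r j * (1 - Real.cos ((w t).φ i - (w t).φ j))) * u.r i
          + (P.p i j * ((w t).r j - (w t).r i)
            + (w t).r i * (1 - Real.cos ((w t).φ i - (w t).φ j))) * u.r j
          + (w t).r i * (w t).r j * Real.sin ((w t).φ i - (w t).φ j) * (u.φ i - u.φ j))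
        / P.dist (w t) i j) t := by
  have hr := hasDerivAt_pi.1 hu.fst
  have hφ := hasDerivAt_pi.1 hu.snd.fst
  have h := HasDerivAt.sqrt (((((hr i).sub (hr j)).pow 2).const_mul (P.p i j)).add
    ((((hr i).const_mul 2).mul (hr j)).mul (((hφ i).sub (hφ j)).cos.const_sub 1)))
    (Real.sqrt_pos.1 hd).ne'
  refine h.congr_deriv ?_
  change _ / (2 * P.dist (w t) i j) = _
  rw [div_eq_div_iff (mul_ne_zero two_ne_zero hd.ne') hd.ne']
  simp only [Pi.sub_apply, Pi.mul_apply, State.r, State.φ]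
  push_cast
  ring

/-- The derivative of the interaction energy `½ ∑ᵢ ∑ⱼ V i j (dist i j)` with respect to the radius
of vehicle `i`. -/
def radialInteraction (P : RingRoad n) (w : State n) (i : Fin n) : ℝ :=
  ∑ j ∈ Finset.univ.erase i,
    (P.p i j * (w.r i - w.r j) + w.r j * (1 - Real.cos (w.φ i - w.φ j)))
      * (deriv (P.V i j) (P.dist w i j) / P.dist w i j)

theorem Z_eq (P : RingRoad n) (w : State n) (i : Fin n) :
    P.Z w i = P.err w i * (Real.cos (w.s i) / ((P.vmax - w.v i) * w.r i ^ 2))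
      - deriv (P.U i) (w.r i) - P.radialInteraction w i :=
  rfl

/-- The differential of `HR` at `w`, applied to `u`. -/
def dHR (P : RingRoad n) (w u : State n) : ℝ :=
  ∑ i, ((P.err w i * P.q (w.r i) (w.s i) (w.v i)
        + w.v i * Real.sin (w.s i) * P.ζ (w.s i) (w.v i)) * u.v i
      + Real.sin (w.s i) * P.γ (w.r i) (w.s i) (w.v i) * u.s i
      - P.Z w i * u.r i + P.ω * P.Φ w i * u.φ i)

/-- The rate at which the friction terms `f₁`, `f₂` dissipate `HR`. -/
def dissipation (P : RingRoad n) (w : State n) : ℝ :=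
  ∑ i, (P.err w i * P.f₁ (P.err w i) + Real.sin (w.s i) * P.f₂ (Real.sin (w.s i)))

namespace IsLongRangeAdmissible

theorem ω_mul_Φ (hP : P.IsLongRangeAdmissible) (w : State n) (i : Fin n) :
    P.ω * P.Φ w i = ∑ j ∈ Finset.univ.erase i, w.r i *
      (deriv (P.V i j) (P.dist w i j) * (w.r j * Real.sin (w.φ i - w.φ j) / P.dist w i j)) := by
  rw [Φ, ← Finset.mul_sum, ← mul_assoc, mul_div_cancel₀ _ hP.ω_pos.ne']

theorem ω_mul_G (hP : P.IsLongRangeAdmissible) (w : State n) (i : Fin n) :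
    P.ω * P.G w i = ∑ j ∈ Finset.univ.erase i, P.κ i j (P.dist w i j) *
      (P.g₁ (P.err w j + P.ω) - P.g₁ (P.err w i + P.ω)) := by
  rw [G, ← mul_assoc, mul_one_div_cancel hP.ω_pos.ne', one_mul]
  simp only [err, sub_add_cancel]

theorem hasDerivAt_interaction (hP : P.IsLongRangeAdmissible) {w : ℝ → State n} {u : State n}
    {t : ℝ} (hu : HasDerivAt w u t) (hw : w t ∈ P.Ω) :
    HasDerivAt (fun τ ↦ 1 / 2 * ∑ i, ∑ j ∈ Finset.univ.erase i, P.V i j (P.dist (w τ) i j))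
      (∑ i, (P.radialInteraction (w t) i * u.r i + P.ω * P.Φ (w t) i * u.φ i)) t := by
  have hV := (HasDerivAt.fun_sum (u := Finset.univ) fun i _ ↦
    HasDerivAt.fun_sum (u := Finset.univ.erase i) fun j hj ↦
      have hij := Finset.ne_of_mem_erase hj
      (hP.hasDerivAt_V hij (hw.2.2.2 i j hij)).comp t
        (hasDerivAt_dist hu (hP.dist_pos hw hij))).const_mul (1 / 2 : ℝ)
  refine hV.congr_deriv ?_
  simp only [radialInteraction, hP.ω_mul_Φ, Finset.sum_mul, ← Finset.sum_add_distrib]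
  refine half_sum_erase_eq_of_eq_add_swap fun i j hij ↦ ?_
  rw [← hP.deriv_V_comm hw hij, ← hP.dist_comm (w t) i j, hP.p_symm j i,
    ← neg_sub ((w t).φ i), Real.cos_neg, Real.sin_neg]
  ring

theorem hasDerivAt_HR (hP : P.IsLongRangeAdmissible) {w : ℝ → State n} {u : State n} {t : ℝ}
    (hu : HasDerivAt w u t) (hw : w t ∈ P.Ω) :
    HasDerivAt (fun τ ↦ P.HR (w τ)) (P.dHR (w t) u) t := by
  have hr : ∀ i, HasDerivAt (fun τ ↦ (w τ).r i) (u.r i) t := hasDerivAt_pi.1 hu.fst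
  have hs : ∀ i, HasDerivAt (fun τ ↦ (w τ).s i) (u.s i) t := hasDerivAt_pi.1 hu.snd.snd.fst
  have hv : ∀ i, HasDerivAt (fun τ ↦ (w τ).v i) (u.v i) t := hasDerivAt_pi.1 hu.snd.snd.snd
  have hK := (HasDerivAt.fun_sum (u := Finset.univ) fun i _ ↦
    hasDerivAt_kinetic (P := P) (hr i) (hs i) (hv i) (hP.r_pos hw i).ne' (hw.2.2.1 i).1.ne'
      (vmax_sub_v_pos hw i).ne').const_mul (1 / 2 : ℝ)
  have hU := HasDerivAt.fun_sum (u := Finset.univ) fun i _ ↦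
    (hP.hasDerivAt_U (i := i) (hw.1 i)).comp t (hr i)
  have hA := (HasDerivAt.fun_sum (u := Finset.univ) fun i _ ↦
    hasDerivAt_orientationPenalty (hs i) (hP.cos_s_sub_pos hw i).ne').const_mul P.A
  refine (((hK.add hU).add (hP.hasDerivAt_interaction hu hw)).add hA).congr_deriv ?_
  simp only [Finset.mul_sum, ← Finset.sum_add_distrib, dHR]
  refine Finset.sum_congr rfl fun i _ ↦ ?_
  rw [Z_eq, err, γ]
  ring

theorem fderiv_HR (hP : P.IsLongRangeAdmissible) (hw : w ∈ P.Ω) (u : State n) :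
    fderiv ℝ P.HR w u = P.dHR w u := by
  have hdiff : DifferentiableAt ℝ P.HR w :=
    (hP.contDiffOn_HR.differentiableOn one_ne_zero).differentiableAt (P.isOpen_Ω.mem_nhds hw)
  have hline : HasDerivAt (fun τ : ℝ ↦ w + τ • u) u 0 := by
    simpa using ((hasDerivAt_id (0 : ℝ)).smul_const u).const_add w
  have h := hP.hasDerivAt_HR hline (by simpa using hw)
  simp only [zero_smul, add_zero] at h
  rw [← hdiff.lineDeriv_eq_fderiv]
  exact h.deriv

theorem sum_Φ (hP : P.IsLongRangeAdmissible) (hw : w ∈ P.Ω) : ∑ i, P.Φ w i = 0 := by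
  simp only [Φ, Finset.mul_sum]
  refine sum_erase_eq_zero_of_antisymm fun i j hij ↦ ?_
  rw [← hP.deriv_V_comm hw hij, ← hP.dist_comm w i j, ← neg_sub (w.φ i), Real.sin_neg]
  ring

theorem sum_err_mul_G_nonpos (hP : P.IsLongRangeAdmissible) (hw : w ∈ P.Ω) :
    ∑ i, P.err w i * (P.ω * P.G w i) ≤ 0 := by
  have hmono : Monotone fun e ↦ P.g₁ (e + P.ω) :=
    hP.g₁_mono.comp (monotone_id.add_const P.ω)
  simp only [hP.ω_mul_G, Finset.mul_sum]
  exact sum_erase_mul_sub_nonpos_of_monovary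
    ((monovary_self (P.err w)).comp_monotone_left hmono).symm
    (fun i j hij ↦ hP.κ_nonneg i j hij.symm _ (hw.2.2.2 i j hij)) fun _ _ ↦ hP.κ_dist_comm hw

theorem sum_sin_mul_M_nonpos (hP : P.IsLongRangeAdmissible) (hw : w ∈ P.Ω) :
    ∑ i, Real.sin (w.s i) * P.M w i ≤ 0 := by
  simp only [M, Finset.mul_sum]
  exact sum_erase_mul_sub_nonpos_of_monovary
    ((monovary_self fun i ↦ Real.sin (w.s i)).comp_monotone_left hP.g₂_mono).symm
    (fun i j hij ↦ hP.κ_nonneg i j hij.symm _ (hw.2.2.2 i j hij)) fun _ _ ↦ hP.κ_dist_comm hw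

theorem q_mul_F (hP : P.IsLongRangeAdmissible) (hw : w ∈ P.Ω) (i : Fin n) :
    P.q (w.r i) (w.s i) (w.v i) * P.F w i
      = -(P.f₁ (P.err w i) + P.ω * (P.Φ w i - P.G w i)) := by
  have := (hP.q_pos hw i).ne'
  rw [F, err]
  field_simp

theorem γ_mul_field_s (hP : P.IsLongRangeAdmissible) (hw : w ∈ P.Ω) (i : Fin n) :
    P.γ (w.r i) (w.s i) (w.v i) * (P.field w).s i
      = -(P.f₂ (Real.sin (w.s i))
        + (P.ζ (w.s i) (w.v i) * P.F w i + P.Z w i) * w.v i - P.M w i) := by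
  have := (hP.γ_pos hw i).ne'
  have := (hw.2.2.1 i).1.ne'
  have := (hP.σ_pos i).ne'
  have := (hP.r_pos hw i).ne'
  change P.γ (w.r i) (w.s i) (w.v i)
    * (w.v i / P.σ i * Real.tan (P.δ w i) - w.v i / w.r i * Real.cos (w.s i)) = _
  rw [δ, Real.tan_arctan]
  field_simp
  ring

theorem dHR_field (hP : P.IsLongRangeAdmissible) (hw : w ∈ P.Ω) :
    P.dHR w (P.field w) = -P.dissipation w + ∑ i, P.err w i * (P.ω * P.G w i)
      + ∑ i, Real.sin (w.s i) * P.M w i + P.ω ^ 2 * ∑ i, P.Φ w i := by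
  simp only [dHR, dissipation, Finset.mul_sum, ← Finset.sum_neg_distrib,
    ← Finset.sum_add_distrib]
  refine Finset.sum_congr rfl fun i _ ↦ ?_
  have hr : (P.field w).r i = -w.v i * Real.sin (w.s i) := rfl
  have hφ : (P.field w).φ i = P.err w i + P.ω := (sub_add_cancel _ _).symm
  have hv : (P.field w).v i = P.F w i := rfl
  rw [mul_assoc (Real.sin (w.s i)), hP.γ_mul_field_s hw, hr, hφ, hv]
  linear_combination P.err w i * hP.q_mul_F hw i

theorem fderiv_HR_field_le (hP : P.IsLongRangeAdmissible) (hw : w ∈ P.Ω) :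
    fderiv ℝ P.HR w (P.field w) ≤ -P.dissipation w := by
  rw [hP.fderiv_HR hw, hP.dHR_field hw, hP.sum_Φ hw]
  linarith [hP.sum_err_mul_G_nonpos hw, hP.sum_sin_mul_M_nonpos hw]

theorem err_mul_f₁_nonneg (hP : P.IsLongRangeAdmissible) (w : State n) (i : Fin n) :
    0 ≤ P.err w i * P.f₁ (P.err w i) := by
  rcases eq_or_ne (P.err w i) 0 with h | h
  · rw [h, zero_mul]
  · exact (hP.f₁_sign _ h).le

theorem sin_mul_f₂_nonneg (hP : P.IsLongRangeAdmissible) (w : State n) (i : Fin n) :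
    0 ≤ Real.sin (w.s i) * P.f₂ (Real.sin (w.s i)) := by
  rcases eq_or_ne (Real.sin (w.s i)) 0 with h | h
  · rw [h, zero_mul]
  · exact (hP.f₂_sign _ h).le

theorem dissipation_nonneg (hP : P.IsLongRangeAdmissible) (w : State n) : 0 ≤ P.dissipation w :=
  Finset.sum_nonneg fun i _ ↦ add_nonneg (hP.err_mul_f₁_nonneg w i) (hP.sin_mul_f₂_nonneg w i)

theorem err_mul_f₁_add_sin_mul_f₂_le_dissipation (hP : P.IsLongRangeAdmissible) (w : State n)
    (i : Fin n) :
    P.err w i * P.f₁ (P.err w i) + Real.sin (w.s i) * P.f₂ (Real.sin (w.s i))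
      ≤ P.dissipation w :=
  Finset.single_le_sum (f := fun i ↦ P.err w i * P.f₁ (P.err w i)
      + Real.sin (w.s i) * P.f₂ (Real.sin (w.s i)))
    (fun j _ ↦ add_nonneg (hP.err_mul_f₁_nonneg w j) (hP.sin_mul_f₂_nonneg w j))
    (Finset.mem_univ i)

theorem err_mul_f₁_le_dissipation (hP : P.IsLongRangeAdmissible) (w : State n) (i : Fin n) :
    P.err w i * P.f₁ (P.err w i) ≤ P.dissipation w :=
  (le_add_of_nonneg_right (hP.sin_mul_f₂_nonneg w i)).trans
    (hP.err_mul_f₁_add_sin_mul_f₂_le_dissipation w i)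

theorem sin_mul_f₂_le_dissipation (hP : P.IsLongRangeAdmissible) (w : State n) (i : Fin n) :
    Real.sin (w.s i) * P.f₂ (Real.sin (w.s i)) ≤ P.dissipation w :=
  (le_add_of_nonneg_left (hP.err_mul_f₁_nonneg w i)).trans
    (hP.err_mul_f₁_add_sin_mul_f₂_le_dissipation w i)

theorem kinetic_nonneg (hP : P.IsLongRangeAdmissible) (hw : w ∈ P.Ω) (i : Fin n) :
    0 ≤ P.kinetic (w.r i) (w.s i) (w.v i) := by
  have := (hw.2.2.1 i).1
  have := vmax_sub_v_pos hw i
  have : 0 < P.b := (one_div_pos.2 (pow_pos hP.Rin_pos 2)).trans hP.b_gt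
  unfold kinetic
  positivity

theorem orientationPenalty_nonneg (hP : P.IsLongRangeAdmissible) (hw : w ∈ P.Ω) (i : Fin n) :
    0 ≤ P.orientationPenalty (w.s i) :=
  sub_nonneg.2 (one_div_le_one_div_of_le (hP.cos_s_sub_pos hw i)
    (sub_le_sub_right (Real.cos_le_one _) _))

theorem V_dist_nonneg (hP : P.IsLongRangeAdmissible) (hw : w ∈ P.Ω) {i j : Fin n}
    (hj : j ∈ Finset.univ.erase i) : 0 ≤ P.V i j (P.dist w i j) :=
  hP.V_nonneg i j (Finset.ne_of_mem_erase hj).symm _ (hw.2.2.2 i j (Finset.ne_of_mem_erase hj))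

theorem sum_kinetic_nonneg (hP : P.IsLongRangeAdmissible) (hw : w ∈ P.Ω) :
    0 ≤ ∑ i, P.kinetic (w.r i) (w.s i) (w.v i) :=
  Finset.sum_nonneg fun i _ ↦ hP.kinetic_nonneg hw i

theorem sum_U_nonneg (hP : P.IsLongRangeAdmissible) (hw : w ∈ P.Ω) : 0 ≤ ∑ i, P.U i (w.r i) :=
  Finset.sum_nonneg fun i _ ↦ hP.U_nonneg i _ (hw.1 i)

theorem sum_V_dist_nonneg (hP : P.IsLongRangeAdmissible) (hw : w ∈ P.Ω) :
    0 ≤ ∑ i, ∑ j ∈ Finset.univ.erase i, P.V i j (P.dist w i j) :=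
  Finset.sum_nonneg fun _ _ ↦ Finset.sum_nonneg fun _ hj ↦ hP.V_dist_nonneg hw hj

theorem A_mul_sum_orientationPenalty_nonneg (hP : P.IsLongRangeAdmissible) (hw : w ∈ P.Ω) :
    0 ≤ P.A * ∑ i, P.orientationPenalty (w.s i) :=
  mul_nonneg hP.A_pos.le (Finset.sum_nonneg fun i _ ↦ hP.orientationPenalty_nonneg hw i)

theorem HR_nonneg (hP : P.IsLongRangeAdmissible) (hw : w ∈ P.Ω) : 0 ≤ P.HR w := by
  linarith [HR_eq P w, hP.sum_kinetic_nonneg hw, hP.sum_U_nonneg hw, hP.sum_V_dist_nonneg hw,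
    hP.A_mul_sum_orientationPenalty_nonneg hw]

theorem kinetic_le_HR (hP : P.IsLongRangeAdmissible) (hw : w ∈ P.Ω) (i : Fin n) :
    1 / 2 * P.kinetic (w.r i) (w.s i) (w.v i) ≤ P.HR w := by
  have := Finset.single_le_sum (fun i _ ↦ hP.kinetic_nonneg hw i) (Finset.mem_univ i)
  linarith [HR_eq P w, hP.sum_U_nonneg hw, hP.sum_V_dist_nonneg hw,
    hP.A_mul_sum_orientationPenalty_nonneg hw]

theorem U_le_HR (hP : P.IsLongRangeAdmissible) (hw : w ∈ P.Ω) (i : Fin n) :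
    P.U i (w.r i) ≤ P.HR w := by
  have := Finset.single_le_sum (f := fun i ↦ P.U i (w.r i)) (fun i _ ↦ hP.U_nonneg i _ (hw.1 i))
    (Finset.mem_univ i)
  linarith [HR_eq P w, hP.sum_kinetic_nonneg hw, hP.sum_V_dist_nonneg hw,
    hP.A_mul_sum_orientationPenalty_nonneg hw]

theorem V_dist_le_HR (hP : P.IsLongRangeAdmissible) (hw : w ∈ P.Ω) {i j : Fin n} (hij : j ≠ i) :
    1 / 2 * P.V i j (P.dist w i j) ≤ P.HR w := by
  have hj := Finset.single_le_sum (f := fun j ↦ P.V i j (P.dist w i j))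
    (fun j hj ↦ hP.V_dist_nonneg hw hj) (Finset.mem_erase.2 ⟨hij, Finset.mem_univ j⟩)
  have hi := Finset.single_le_sum (fun i _ ↦ Finset.sum_nonneg fun j hj ↦
    hP.V_dist_nonneg hw (i := i) (j := j) hj) (Finset.mem_univ i)
  linarith [HR_eq P w, hP.sum_kinetic_nonneg hw, hP.sum_U_nonneg hw,
    hP.A_mul_sum_orientationPenalty_nonneg hw]

theorem orientationPenalty_le_HR (hP : P.IsLongRangeAdmissible) (hw : w ∈ P.Ω) (i : Fin n) :
    P.A * P.orientationPenalty (w.s i) ≤ P.HR w := by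
  have := mul_le_mul_of_nonneg_left (Finset.single_le_sum
    (fun i _ ↦ hP.orientationPenalty_nonneg hw i) (Finset.mem_univ i)) hP.A_pos.le
  linarith [HR_eq P w, hP.sum_kinetic_nonneg hw, hP.sum_U_nonneg hw, hP.sum_V_dist_nonneg hw]

end IsLongRangeAdmissible

theorem r_mem_Icc (hw : w ∈ closure P.Ω) (i : Fin n) : w.r i ∈ Icc P.Rin P.Rout :=
  closure_minimal (t := (fun w : State n ↦ w.r i) ⁻¹' Icc P.Rin P.Rout)
    (fun _ h ↦ Ioo_subset_Icc_self (h.1 i))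
    (isClosed_Icc.preimage (State.continuous_r i)) hw

theorem s_mem_Icc (hw : w ∈ closure P.Ω) (i : Fin n) : w.s i ∈ Icc (-P.Θ) P.Θ :=
  closure_minimal (t := (fun w : State n ↦ w.s i) ⁻¹' Icc (-P.Θ) P.Θ)
    (fun _ h ↦ Ioo_subset_Icc_self (h.2.1 i))
    (isClosed_Icc.preimage (State.continuous_s i)) hw

theorem v_mem_Icc (hw : w ∈ closure P.Ω) (i : Fin n) : w.v i ∈ Icc 0 P.vmax :=
  closure_minimal (t := (fun w : State n ↦ w.v i) ⁻¹' Icc 0 P.vmax)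
    (fun _ h ↦ Ioo_subset_Icc_self (h.2.2.1 i))
    (isClosed_Icc.preimage (State.continuous_v i)) hw

theorem L_le_dist (hw : w ∈ closure P.Ω) {i j : Fin n} (hij : j ≠ i) :
    P.L i j ≤ P.dist w i j :=
  closure_minimal (fun _ h ↦ (h.2.2.2 i j hij).le)
    (isClosed_Ici.preimage (P.continuous_dist i j)) hw

theorem exists_eq_of_mem_frontier (hw : w ∈ frontier P.Ω) :
    (∃ i, w.r i = P.Rin ∨ w.r i = P.Rout) ∨ (∃ i, w.s i = -P.Θ ∨ w.s i = P.Θ) ∨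
      (∃ i, w.v i = 0 ∨ w.v i = P.vmax) ∨ ∃ i j, j ≠ i ∧ P.dist w i j = P.L i j := by
  rw [P.isOpen_Ω.frontier_eq] at hw
  obtain ⟨hcl, hΩ⟩ := hw
  by_contra! h
  obtain ⟨hr, hs, hv, hd⟩ := h
  refine hΩ ⟨fun i ↦ ?_, fun i ↦ ?_, fun i ↦ ?_, fun i j hij ↦ ?_⟩
  · exact ⟨(r_mem_Icc hcl i).1.lt_of_ne' (hr i).1, (r_mem_Icc hcl i).2.lt_of_ne (hr i).2⟩
  · exact ⟨(s_mem_Icc hcl i).1.lt_of_ne' (hs i).1, (s_mem_Icc hcl i).2.lt_of_ne (hs i).2⟩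
  · exact ⟨(v_mem_Icc hcl i).1.lt_of_ne' (hv i).1, (v_mem_Icc hcl i).2.lt_of_ne (hv i).2⟩
  · exact (L_le_dist hcl hij).lt_of_ne' (hd i j hij)

namespace IsLongRangeAdmissible

theorem tendsto_U_atTop (hP : P.IsLongRangeAdmissible) {i : Fin n}
    (h : w.r i = P.Rin ∨ w.r i = P.Rout) :
    Tendsto (fun y : State n ↦ P.U i (y.r i)) (𝓝[P.Ω] w) atTop := by
  have hr := (State.continuous_r i).continuousWithinAt (s := P.Ω) (x := w)
  rcases h with h | h
  · refine (hP.U_tendsto_Rin i).comp ?_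
    rw [← h]
    exact hr.tendsto_nhdsWithin fun y hy ↦ h ▸ (hy.1 i).1
  · refine (hP.U_tendsto_Rout i).comp ?_
    rw [← h]
    exact hr.tendsto_nhdsWithin fun y hy ↦ h ▸ (hy.1 i).2

theorem tendsto_V_dist_atTop (hP : P.IsLongRangeAdmissible) {i j : Fin n} (hij : j ≠ i)
    (h : P.dist w i j = P.L i j) :
    Tendsto (fun y : State n ↦ P.V i j (P.dist y i j)) (𝓝[P.Ω] w) atTop := by
  refine (hP.V_tendsto i j hij.symm).comp ?_
  rw [← h]
  exact (P.continuous_dist i j).continuousWithinAt.tendsto_nhdsWithin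
    fun y hy ↦ h ▸ hy.2.2.2 i j hij

theorem tendsto_orientationPenalty_atTop (hP : P.IsLongRangeAdmissible) {i : Fin n}
    (h : w.s i = -P.Θ ∨ w.s i = P.Θ) :
    Tendsto (fun y : State n ↦ P.orientationPenalty (y.s i)) (𝓝[P.Ω] w) atTop := by
  have h0 : Real.cos (w.s i) - Real.cos P.Θ = 0 := by
    rcases h with h | h <;> rw [h] <;> simp only [Real.cos_neg, sub_self]
  have hcont : Continuous fun y : State n ↦ Real.cos (y.s i) - Real.cos P.Θ := by fun_prop
  have hgap : Tendsto (fun y : State n ↦ Real.cos (y.s i) - Real.cos P.Θ) (𝓝[P.Ω] w) (𝓝[>] 0) :=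
    h0 ▸ hcont.continuousWithinAt.tendsto_nhdsWithin fun y hy ↦ h0 ▸ hP.cos_s_sub_pos hy i
  simp only [orientationPenalty, one_div, sub_eq_add_neg]
  exact tendsto_atTop_add_const_right _ _ hgap.inv_tendsto_nhdsGT_zero

theorem err_ne_zero (hP : P.IsLongRangeAdmissible) (hw : w ∈ closure P.Ω) {i : Fin n}
    (h : w.v i = 0 ∨ w.v i = P.vmax) : P.err w i ≠ 0 := by
  rcases h with h | h
  · simpa [err, h] using hP.ω_pos.ne'
  · have hr : 0 < w.r i := hP.Rin_pos.trans_le (r_mem_Icc hw i).1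
    have hcos : Real.cos P.Θ ≤ Real.cos (w.s i) := by
      rw [← Real.cos_abs (w.s i)]
      exact Real.cos_le_cos_of_nonneg_of_le_pi (abs_nonneg _)
        (by linarith [hP.Θ_lt, Real.pi_pos]) (abs_le.2 (s_mem_Icc hw i))
    have hlt : w.r i * P.ω < P.vmax * Real.cos (w.s i) := by
      nlinarith [hP.Rout_mul_ω_lt, hP.vmax_pos, hP.ω_pos, (r_mem_Icc hw i).2]
    rw [err, h, sub_ne_zero, div_mul_eq_mul_div]
    exact ((lt_div_iff₀' hr).2 hlt).ne'

theorem tendsto_kinetic_atTop (hP : P.IsLongRangeAdmissible) (hw : w ∈ closure P.Ω) {i : Fin n}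
    (h : w.v i = 0 ∨ w.v i = P.vmax) :
    Tendsto (fun y : State n ↦ P.kinetic (y.r i) (y.s i) (y.v i)) (𝓝[P.Ω] w) atTop := by
  have hr : w.r i ≠ 0 := (hP.Rin_pos.trans_le (r_mem_Icc hw i).1).ne'
  have hb : 0 < P.b := (one_div_pos.2 (pow_pos hP.Rin_pos 2)).trans hP.b_gt
  have hnum : ContinuousWithinAt (fun y : State n ↦
      (y.v i / y.r i * Real.cos (y.s i) - P.ω) ^ 2 + P.b * y.v i ^ 2 * Real.sin (y.s i) ^ 2)
      P.Ω w := by fun_prop (disch := exact hr)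
  have hnum0 : 0 < P.err w i ^ 2 + P.b * w.v i ^ 2 * Real.sin (w.s i) ^ 2 := by
    have := hP.err_ne_zero hw h
    positivity
  have h0 : (P.vmax - w.v i) * w.v i = 0 := by
    rcases h with h | h <;> rw [h] <;> ring
  have hcont : Continuous fun y : State n ↦ (P.vmax - y.v i) * y.v i := by fun_prop
  have hden : Tendsto (fun y : State n ↦ (P.vmax - y.v i) * y.v i) (𝓝[P.Ω] w) (𝓝[>] 0) :=
    h0 ▸ hcont.continuousWithinAt.tendsto_nhdsWithin
      fun y hy ↦ h0 ▸ mul_pos (vmax_sub_v_pos hy i) (hy.2.2.1 i).1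
  simp only [kinetic, div_eq_mul_inv _ ((_ - _) * _)]
  exact hnum.tendsto.pos_mul_atTop hnum0 hden.inv_tendsto_nhdsGT_zero

theorem tendsto_HR_atTop (hP : P.IsLongRangeAdmissible) (hw : w ∈ frontier P.Ω) :
    Tendsto P.HR (𝓝[P.Ω] w) atTop := by
  have of_le {g : State n → ℝ} (hg : Tendsto g (𝓝[P.Ω] w) atTop) (hle : ∀ y ∈ P.Ω, g y ≤ P.HR y) :
      Tendsto P.HR (𝓝[P.Ω] w) atTop :=
    tendsto_atTop_mono' _ (eventually_mem_nhdsWithin.mono hle) hg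
  have hhalf : (0 : ℝ) < 1 / 2 := by norm_num
  rcases exists_eq_of_mem_frontier hw with ⟨i, h⟩ | ⟨i, h⟩ | ⟨i, h⟩ | ⟨i, j, hij, h⟩
  · exact of_le (hP.tendsto_U_atTop h) fun y hy ↦ hP.U_le_HR hy i
  · exact of_le ((hP.tendsto_orientationPenalty_atTop h).const_mul_atTop hP.A_pos)
      fun y hy ↦ hP.orientationPenalty_le_HR hy i
  · exact of_le ((hP.tendsto_kinetic_atTop (frontier_subset_closure hw) h).const_mul_atTop hhalf)
      fun y hy ↦ hP.kinetic_le_HR hy i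
  · exact of_le ((hP.tendsto_V_dist_atTop hij h).const_mul_atTop hhalf)
      fun y hy ↦ hP.V_dist_le_HR hy hij

end IsLongRangeAdmissible

/-- The translation of the state space that adds `k i` full turns to the angle `φ i`. -/
def turn (k : Fin n → ℤ) : State n := (0, fun i ↦ k i * (2 * Real.pi), 0, 0)

section Turn

variable (P w) (k : Fin n → ℤ) (i j : Fin n)

@[simp] theorem add_turn_r : (w + turn k).r = w.r := add_zero _

@[simp] theorem add_turn_s : (w + turn k).s = w.s := add_zero _

@[simp] theorem add_turn_v : (w + turn k).v = w.v := add_zero _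

theorem add_turn_φ : (w + turn k).φ i = w.φ i + k i * (2 * Real.pi) := rfl

theorem add_turn_φ_sub :
    (w + turn k).φ i - (w + turn k).φ j = w.φ i - w.φ j + (k i - k j : ℤ) * (2 * Real.pi) := by
  rw [add_turn_φ, add_turn_φ]
  push_cast
  ring

@[simp] theorem cos_add_turn_φ_sub :
    Real.cos ((w + turn k).φ i - (w + turn k).φ j) = Real.cos (w.φ i - w.φ j) := by
  rw [add_turn_φ_sub, Real.cos_add_int_mul_two_pi]

@[simp] theorem sin_add_turn_φ_sub :
    Real.sin ((w + turn k).φ i - (w + turn k).φ j) = Real.sin (w.φ i - w.φ j) := by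
  rw [add_turn_φ_sub, Real.sin_add_int_mul_two_pi]

@[simp] theorem dist_add_turn : P.dist (w + turn k) i j = P.dist w i j := by simp [dist]

theorem add_turn_mem_Ω_iff : w + turn k ∈ P.Ω ↔ w ∈ P.Ω := by simp [Ω]

theorem periodic_HR : P.HR.Periodic (turn k) := fun w ↦ by simp [HR]

theorem periodic_F : P.F.Periodic (turn k) := fun w ↦ by ext i; simp [F, Φ, G]

theorem periodic_δ : P.δ.Periodic (turn k) := fun w ↦ by
  ext i; simp [δ, Z, M, P.periodic_F k w]

theorem periodic_field : P.field.Periodic (turn k) := fun w ↦ by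
  simp [field, bicycle, P.periodic_F k w, P.periodic_δ k w]

theorem periodic_err : Function.Periodic (fun w ↦ P.err w i) (turn k) := fun w ↦ by simp [err]

theorem periodic_dissipation : P.dissipation.Periodic (turn k) := fun w ↦ by
  simp [dissipation, err]

theorem exists_turn : ∃ k : Fin n → ℤ, ∀ i, (w + turn k).φ i ∈ Icc 0 (2 * Real.pi) := by
  refine ⟨fun i ↦ -toIcoDiv Real.two_pi_pos 0 (w.φ i), fun i ↦ ?_⟩
  have hmem := sub_toIcoDiv_zsmul_mem_Ico Real.two_pi_pos 0 (w.φ i)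
  rw [zero_add, zsmul_eq_mul] at hmem
  rw [add_turn_φ, Int.cast_neg, neg_mul, ← sub_eq_add_neg]
  exact Ico_subset_Icc_self hmem

theorem exists_isCompact_add_turn_mem :
    ∃ K : Set (State n), IsCompact K ∧ ∀ w ∈ P.Ω, ∃ k, w + turn k ∈ K := by
  refine ⟨Icc (fun _ ↦ P.Rin, fun _ ↦ 0, fun _ ↦ -P.Θ, fun _ ↦ 0)
    (fun _ ↦ P.Rout, fun _ ↦ 2 * Real.pi, fun _ ↦ P.Θ, fun _ ↦ P.vmax), isCompact_Icc,
    fun w hw ↦ ?_⟩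
  obtain ⟨k, hk⟩ := exists_turn w
  obtain ⟨hr, hs, hv, -⟩ := (P.add_turn_mem_Ω_iff w k).2 hw
  exact ⟨k, ⟨fun i ↦ (hr i).1.le, fun i ↦ (hk i).1, fun i ↦ (hs i).1.le, fun i ↦ (hv i).1.le⟩,
    fun i ↦ (hr i).2.le, fun i ↦ (hk i).2, fun i ↦ (hs i).2.le, fun i ↦ (hv i).2.le⟩

end Turn

namespace IsLongRangeAdmissible

theorem isPeriodicLyapunov (hP : P.IsLongRangeAdmissible) :
    IsPeriodicLyapunov turn P.Ω P.HR P.field where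
  isOpen := P.isOpen_Ω
  contDiffOn := hP.contDiffOn_HR
  tendsto_atTop _ hw := hP.tendsto_HR_atTop hw
  add_mem_iff k w := P.add_turn_mem_Ω_iff w k
  periodic := P.periodic_HR
  exists_isCompact := P.exists_isCompact_add_turn_mem
  contDiffOn_field := hP.contDiffOn_field
  periodic_field := P.periodic_field
  fderiv_nonpos w hw :=
    (hP.fderiv_HR_field_le hw).trans (neg_nonpos.2 (hP.dissipation_nonneg w))

theorem contDiffOn_dissipation (hP : P.IsLongRangeAdmissible) :
    ContDiffOn ℝ 1 P.dissipation P.Ω :=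
  ContDiffOn.sum fun i _ ↦ ((hP.contDiffOn_err i).mul
    (hP.f₁_contDiff.comp_contDiffOn (hP.contDiffOn_err i))).add
    (ContDiffOn.mul (by fun_prop) (hP.f₂_contDiff.comp_contDiffOn (by fun_prop)))

section Convergence

variable {w : ℝ → State n} (hP : P.IsLongRangeAdmissible)
  (hw : IsIntegralCurveOn w (fun _ ↦ P.field) (Ici 0)) (hmem : MapsTo w (Ici 0) P.Ω)

include hP hw hmem

theorem tendsto_dissipation : Tendsto (fun t ↦ P.dissipation (w t)) atTop (𝓝 0) :=
  hP.isPeriodicLyapunov.tendsto_zero_of_fderiv_le_neg hw hmem hP.contDiffOn_dissipation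
    P.periodic_dissipation (fun w _ ↦ hP.dissipation_nonneg w)
    fun _ hx ↦ hP.fderiv_HR_field_le hx

theorem tendsto_err_mul_f₁ (i : Fin n) :
    Tendsto (fun t ↦ P.err (w t) i * P.f₁ (P.err (w t) i)) atTop (𝓝 0) :=
  squeeze_zero (fun t ↦ hP.err_mul_f₁_nonneg (w t) i)
    (fun t ↦ hP.err_mul_f₁_le_dissipation (w t) i) (hP.tendsto_dissipation hw hmem)

theorem tendsto_sin_mul_f₂ (i : Fin n) :
    Tendsto (fun t ↦ Real.sin ((w t).s i) * P.f₂ (Real.sin ((w t).s i))) atTop (𝓝 0) :=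
  squeeze_zero (fun t ↦ hP.sin_mul_f₂_nonneg (w t) i)
    (fun t ↦ hP.sin_mul_f₂_le_dissipation (w t) i) (hP.tendsto_dissipation hw hmem)

theorem tendsto_err (i : Fin n) : Tendsto (fun t ↦ P.err (w t) i) atTop (𝓝 0) := by
  obtain ⟨C, hC⟩ := hP.isPeriodicLyapunov.exists_bound_on_sublevelOn
    (hP.contDiffOn_err i).continuousOn (fun k ↦ P.periodic_err k i) (P.HR (w 0))
  have hsub := hP.isPeriodicLyapunov.mapsTo_sublevelOn ordConnected_Ici self_mem_Ici le_rfl hw hmem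
  refine tendsto_of_tendsto_comp_of_isCompact (isCompact_Icc (a := -(C : ℝ)) (b := C)) ?_
    (continuous_id.mul hP.f₁_contDiff.continuous) ?_ (hP.tendsto_err_mul_f₁ hw hmem i)
  · filter_upwards [Ici_mem_atTop 0] with t ht using abs_le.1 (hC _ (hsub ht))
  · intro x _ hx
    by_contra hne
    exact (hP.f₁_sign x hne).ne' hx

theorem tendsto_s (i : Fin n) : Tendsto (fun t ↦ (w t).s i) atTop (𝓝 0) := by
  refine tendsto_of_tendsto_comp_of_isCompact (isCompact_Icc (a := -P.Θ) (b := P.Θ)) ?_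
    (Real.continuous_sin.mul (hP.f₂_contDiff.continuous.comp Real.continuous_sin)) ?_
    (hP.tendsto_sin_mul_f₂ hw hmem i)
  · filter_upwards [Ici_mem_atTop 0] with t ht using Ioo_subset_Icc_self ((hmem ht).2.1 i)
  · intro x hx hzero
    have hsin : Real.sin x = 0 := by
      by_contra hne
      exact (hP.f₂_sign _ hne).ne' hzero
    exact (Real.sin_eq_zero_iff_of_lt_of_lt (by linarith [hx.1, hP.Θ_lt, Real.pi_pos])
      (by linarith [hx.2, hP.Θ_lt, Real.pi_pos])).1 hsin

theorem tendsto_v_div_r (i : Fin n) :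
    Tendsto (fun t ↦ (w t).v i / (w t).r i) atTop (𝓝 P.ω) := by
  have hcos := (Real.continuous_cos.tendsto 0).comp (hP.tendsto_s hw hmem i)
  have hlim := ((hP.tendsto_err hw hmem i).add_const P.ω).div hcos (by simp)
  rw [zero_add, Real.cos_zero, div_one] at hlim
  refine hlim.congr' ?_
  filter_upwards [Ici_mem_atTop 0] with t ht
  have hne : Real.cos ((w t).s i) ≠ 0 := (hP.cos_s_pos (hmem ht) i).ne'
  simp only [Pi.div_apply, Function.comp_apply, err, sub_add_cancel, mul_div_cancel_right₀ _ hne]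

theorem tendsto_field_s (i : Fin n) :
    Tendsto (fun t ↦ (P.field (w t)).s i) atTop (𝓝 0) := by
  refine tendsto_deriv_zero_of_tendsto ?_ (fun t ht ↦ State.hasDerivWithinAt_s (hw t ht) i)
    (hP.tendsto_s hw hmem i)
  exact hP.isPeriodicLyapunov.uniformContinuousOn_comp hw hmem
    ((State.contDiff_s i).comp_contDiffOn hP.contDiffOn_field)
    fun k w ↦ by rw [Function.comp_apply, P.periodic_field k w, Function.comp_apply]

theorem tendsto_deriv_s (i : Fin n) :
    Tendsto (deriv fun t ↦ (w t).s i) atTop (𝓝 0) := by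
  refine (hP.tendsto_field_s hw hmem i).congr' ?_
  filter_upwards [Ioi_mem_atTop 0] with t ht
  have hs := State.hasDerivWithinAt_s (hw t (mem_Ici.2 (le_of_lt ht))) i
  exact (hs.hasDerivAt (Ici_mem_nhds ht)).deriv.symm

-- Only the ratio `v i / r i` is known to converge, so Barbalat's lemma cannot be applied to `v i`
-- itself; its proxy is `v i - ω * r i`, whose derivative is `F i + ω * sin (s i) * v i`.
theorem tendsto_v_sub_ω_mul_r (i : Fin n) :
    Tendsto (fun t ↦ (w t).v i - P.ω * (w t).r i) atTop (𝓝 0) := by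
  have hlim : Tendsto (fun t ↦ (w t).v i / (w t).r i - P.ω) atTop (𝓝 0) := by
    simpa only [sub_self] using (hP.tendsto_v_div_r hw hmem i).sub_const P.ω
  have hbdd : IsBoundedUnder (· ≤ ·) atTop (norm ∘ fun t ↦ (w t).r i) :=
    isBoundedUnder_of_eventually_le (a := P.Rout) <| by
      filter_upwards [Ici_mem_atTop 0] with t ht
      exact (abs_of_pos (hP.r_pos (hmem ht) i)).trans_le ((hmem ht).1 i).2.le
  refine (hlim.zero_mul_isBoundedUnder_le hbdd).congr' ?_
  filter_upwards [Ici_mem_atTop 0] with t ht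
  rw [sub_mul, div_mul_cancel₀ _ (hP.r_pos (hmem ht) i).ne']

theorem tendsto_sin_mul_v (i : Fin n) :
    Tendsto (fun t ↦ Real.sin ((w t).s i) * (w t).v i) atTop (𝓝 0) := by
  have hsin := (Real.continuous_sin.tendsto 0).comp (hP.tendsto_s hw hmem i)
  rw [Real.sin_zero] at hsin
  refine hsin.zero_mul_isBoundedUnder_le (isBoundedUnder_of_eventually_le (a := P.vmax) ?_)
  filter_upwards [Ici_mem_atTop 0] with t ht
  exact (abs_of_pos ((hmem ht).2.2.1 i).1).trans_le ((hmem ht).2.2.1 i).2.le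

theorem tendsto_F (i : Fin n) : Tendsto (fun t ↦ P.F (w t) i) atTop (𝓝 0) := by
  have hbarbalat : Tendsto (fun t ↦ P.F (w t) i + P.ω * (Real.sin ((w t).s i) * (w t).v i))
      atTop (𝓝 0) := by
    refine tendsto_deriv_zero_of_tendsto (a := 0) ?_ (fun t ht ↦ ?_)
      (hP.tendsto_v_sub_ω_mul_r hw hmem i)
    · exact hP.isPeriodicLyapunov.uniformContinuousOn_comp hw hmem
        (g := fun x ↦ P.F x i + P.ω * (Real.sin (x.s i) * x.v i))
        ((hP.contDiffOn_F i).add (by fun_prop)) fun k x ↦ by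
          simp only [P.periodic_F k x, add_turn_s, add_turn_v]
    · refine ((State.hasDerivWithinAt_v (hw t ht) i).sub
        ((State.hasDerivWithinAt_r (hw t ht) i).const_mul P.ω)).congr_deriv ?_
      simp only [field, bicycle, State.r, State.s, State.v]
      ring
  simpa only [mul_zero, sub_zero, add_sub_cancel_right] using
    hbarbalat.sub ((hP.tendsto_sin_mul_v hw hmem i).const_mul P.ω)

end Convergence

theorem exists_monotone_input_bound (hP : P.IsLongRangeAdmissible) :
    ∃ B : ℝ → ℝ, Monotone B ∧ (∀ c, 0 ≤ B c) ∧
      ∀ c, ∀ w ∈ sublevelOn P.Ω P.HR c, ∀ i, |P.F w i| + |P.δ w i| ≤ B c := by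
  obtain ⟨B₁, hmono₁, hnonneg₁, hle₁⟩ := hP.isPeriodicLyapunov.exists_monotone_norm_le
    (continuousOn_pi.2 fun i ↦ (hP.contDiffOn_F i).continuousOn) P.periodic_F
  obtain ⟨B₂, hmono₂, hnonneg₂, hle₂⟩ := hP.isPeriodicLyapunov.exists_monotone_norm_le
    (continuousOn_pi.2 fun i ↦ (hP.contDiffOn_δ i).continuousOn) P.periodic_δ
  exact ⟨B₁ + B₂, hmono₁.add hmono₂, fun c ↦ add_nonneg (hnonneg₁ c) (hnonneg₂ c),
    fun c w hw i ↦ add_le_add ((norm_le_pi_norm (P.F w) i).trans (hle₁ c w hw))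
      ((norm_le_pi_norm (P.δ w) i).trans (hle₂ c w hw))⟩

end IsLongRangeAdmissible

end RingRoad

end

theorem theorem2_general (n : ℕ) (P : RingRoad n) (hP : P.IsLongRangeAdmissible) :
    (∀ w₀ ∈ P.Ω, ∃ w : ℝ → State n,
      P.IsSolutionOn w₀ (Set.Ici 0) w ∧
      (∀ t, 0 ≤ t → w t ∈ P.Ω) ∧
      (∀ J : Set ℝ, J.OrdConnected → 0 ∈ J → J ⊆ Set.Ici 0 →
        ∀ y : ℝ → State n, P.IsSolutionOn w₀ J y → Set.EqOn y w J) ∧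
      ∀ i : Fin n,
        Filter.Tendsto (fun t => (w t).s i) Filter.atTop (nhds 0) ∧
        Filter.Tendsto (fun t => (w t).v i / (w t).r i) Filter.atTop (nhds P.ω) ∧
        Filter.Tendsto (fun t => deriv (fun τ => (w τ).s i) t) Filter.atTop (nhds 0) ∧
        Filter.Tendsto (fun t => P.F (w t) i) Filter.atTop (nhds 0)) ∧
    ∃ P₂ : ℝ → ℝ, MonotoneOn P₂ (Set.Ici 0) ∧ (∀ x, 0 ≤ x → 0 ≤ P₂ x) ∧
      ∀ w₀ ∈ P.Ω, 0 ≤ P.HR w₀ ∧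
        ∀ w : ℝ → State n, P.IsSolutionOn w₀ (Set.Ici 0) w →
          ∀ t, 0 ≤ t → ∀ i : Fin n, |P.F (w t) i| + |P.δ (w t) i| ≤ P₂ (P.HR w₀) := by
  have hL := hP.isPeriodicLyapunov
  refine ⟨fun w₀ hw₀ ↦ ?_, ?_⟩
  · obtain ⟨w, h0, hmem, hw⟩ := hL.exists_isIntegralCurveOn_Ici hw₀
    refine ⟨w, RingRoad.isSolutionOn_iff.2 ⟨h0, hmem, hw⟩, fun _ ht ↦ hmem ht,
      fun J hJ h0J hJ0 y hy ↦ ?_, fun i ↦ ⟨hP.tendsto_s hw hmem i, hP.tendsto_v_div_r hw hmem i,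
        hP.tendsto_deriv_s hw hmem i, hP.tendsto_F hw hmem i⟩⟩
    obtain ⟨hy0, hymem, hy⟩ := RingRoad.isSolutionOn_iff.1 hy
    exact hL.eqOn_of_isIntegralCurveOn hJ h0J hJ0 hy hymem (hw.mono hJ0) (hmem.mono_left hJ0)
      (hy0.trans h0.symm)
  · obtain ⟨B, hmono, hnonneg, hle⟩ := hP.exists_monotone_input_bound
    refine ⟨B, hmono.monotoneOn _, fun c _ ↦ hnonneg c, fun w₀ hw₀ ↦
      ⟨hP.HR_nonneg hw₀, fun w hsol t ht i ↦ hle _ (w t) ?_ i⟩⟩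
    obtain ⟨rfl, hmem, hw⟩ := RingRoad.isSolutionOn_iff.1 hsol
    exact hL.mapsTo_sublevelOn ordConnected_Ici self_mem_Ici le_rfl hw hmem ht

theorem theorem2 (n : ℕ) (P : RingRoad n) (hP : P.IsAdmissible) :
    (∀ w₀ ∈ P.Ω, ∃ w : ℝ → State n,
      P.IsSolutionOn w₀ (Set.Ici 0) w ∧
      (∀ t, 0 ≤ t → w t ∈ P.Ω) ∧
      (∀ J : Set ℝ, J.OrdConnected → 0 ∈ J → J ⊆ Set.Ici 0 →
        ∀ y : ℝ → State n, P.IsSolutionOn w₀ J y → Set.EqOn y w J) ∧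
      ∀ i : Fin n,
        Filter.Tendsto (fun t => (w t).s i) Filter.atTop (nhds 0) ∧
        Filter.Tendsto (fun t => (w t).v i / (w t).r i) Filter.atTop (nhds P.ω) ∧
        Filter.Tendsto (fun t => deriv (fun τ => (w τ).s i) t) Filter.atTop (nhds 0) ∧
        Filter.Tendsto (fun t => P.F (w t) i) Filter.atTop (nhds 0)) ∧
    ∃ P₂ : ℝ → ℝ, MonotoneOn P₂ (Set.Ici 0) ∧ (∀ x, 0 ≤ x → 0 ≤ P₂ x) ∧
      ∀ w₀ ∈ P.Ω, 0 ≤ P.HR w₀ ∧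
        ∀ w : ℝ → State n, P.IsSolutionOn w₀ (Set.Ici 0) w →
          ∀ t, 0 ≤ t → ∀ i : Fin n, |P.F (w t) i| + |P.δ (w t) i| ≤ P₂ (P.HR w₀) := by
  exact theorem2_general n P hP.isLongRangeAdmissible
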